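/- **Proposition (even spin groups).** For $n\ge 1$ let $Spin(2n+2)$ carry the bi-invariant Riemannian metric $-\tfrac12\mathrm{Tr}(R^{-1}dR\otimes R^{-1}dR)$, where $R=R_g$ is the rotation of $\mathbb R^{2n+2}$ covered by $g$, and let $d_n$ be its Riemannian distance. Let $p$ be the last vector of the canonical basis of $\mathbb R^{2n+2}$, $p'$ the last but one, and $S^{2n}$ the unit sphere of $p^\perp=\mathbb R^{2n+1}$. Let $Spin(2n)\subset Spin(2n+2)$ be the standard subgroup (fixing $p$ and $p'$). (a) The map $g\mapsto (R_gp,R_gp')$ is a principal $Spin(2n)$-bundle (for right translations) over the Stiefel manifold $V_2(\mathbb R^{2n+2})=Spin(2n+2)/Spin(2n)$ of orthonormal pairs $(x,y)$. Identify $V_2(\mathbb R^{2n+2})$ with $B_n=S^{2n+1}\times S^{2n}$ by the bijection $(x,y)\mapsto (x,\rho_x^{-1}y)$, where, for $x\ne -p$, $\rho_x$ is the rotation which takes $p$ to $x$ and is the identity on $\{p,x\}^\perp$, and $\rho_{-p}^{-1}y:=y$. The resulting map $\pi_n:Spin(2n+2)\to S^{2n+1}\times S^{2n}$ is onto, its fibres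 are exactly the cosets $g\,Spin(2n)$, and it is a (continuous, locally trivial) principal $Spin(2n)$-bundle over $(S^{2n+1}\setminus\{-p\})\times S^{2n}$. (b) There is exactly one bi-invariant probability measure $\mu_n$ on (the Borel sets of) $Spin(2n+2)$, and $\mu_n\big(\pi_n^{-1}(\{-p\}\times S^{2n})\big)=0$. (c) For each $n$ let $S_n=E_n\times E_n'$ be a bi-equator of $B_n$, where $E_n=\{x\in S^{2n+1}:\langle x,u_n\rangle=0\}$ and $E_n'=\{z\in S^{2n}:\langle z,v_n\rangle=0\}$ for unit vectors $u_n,v_n$, with $-p\notin E_n$. Then $\Sigma_n=\pi_n^{-1}(S_n)$ is a proper closed subset and a smooth embedded submanifold of codimension two of the connected group $Spin(2n+2)$, $\mu_n$ is positive on non-empty open sets, and $\mu_n$ concentrates on $\Sigma_n$: there are $\varepsilon_n>0$ with $\varepsilon_n\to 0$ such that $$\lim_{n\to\infty}\mu_n\big(Spin(2n+2)\setminus\{g: d_n(g,s)<\varepsilon_n\text{ for some }s\in\Sigma_n\}\big)=0 .$$ -/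

import Mathlib

open Set Filter Topology MeasureTheory
open scoped InnerProductSpace ContDiff ENNReal

noncomputable section

/-! ### The spin groups -/

/-- Euclidean space `ℝ^N`. -/
abbrev Euc (N : ℕ) : Type := EuclideanSpace ℝ (Fin N)

/-- The unit sphere of `ℝ^N` (of dimension `N - 1`). -/
abbrev USphere (N : ℕ) : Type := Metric.sphere (0 : Euc N) 1

/-- The negative definite form `v ↦ -‖v‖²`. -/
def stdForm (N : ℕ) : QuadraticForm ℝ (Euc N) :=
  -(LinearMap.BilinMap.toQuadraticMap (innerₗ (Euc N)))

theorem stdForm_apply {N : ℕ} (v : Euc N) : stdForm N v = -(‖v‖ ^ 2) := by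
  simp [stdForm]

/-- The real Clifford algebra in which `v * v = -‖v‖²` for `v : ℝ^N`. -/
abbrev Cl (N : ℕ) : Type := CliffordAlgebra (stdForm N)

/-- The compact group `Spin(N)`: the products of an even number of unit vectors in the Clifford
algebra. -/
abbrev Spin (N : ℕ) : Type := ↥(spinGroup (stdForm N))

/-- The Clifford algebra carries its canonical topology of a (finite-dimensional) real vector
space, and `Spin N` the induced one. -/
instance Cl.instTopologicalSpace (N : ℕ) : TopologicalSpace (Cl N) := moduleTopology ℝ (Cl N)

instance Spin.instMeasurableSpace (N : ℕ) : MeasurableSpace (Spin N) := borel (Spin N)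

instance Spin.instBorelSpace (N : ℕ) : BorelSpace (Spin N) := ⟨rfl⟩

/-- A linear left inverse of the inclusion of vectors in the Clifford algebra. -/
def vecPart (N : ℕ) : Cl N →ₗ[ℝ] Euc N :=
  letI : Invertible (2 : ℝ) := invertibleOfNonzero two_ne_zero
  ExteriorAlgebra.ιInv ∘ₗ (CliffordAlgebra.equivExterior (stdForm N)).toLinearMap

theorem vecPart_ι {N : ℕ} (v : Euc N) : vecPart N (CliffordAlgebra.ι (stdForm N) v) = v := by
  let _ : Invertible (2 : ℝ) := invertibleOfNonzero two_ne_zero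
  have h : CliffordAlgebra.equivExterior (stdForm N) (CliffordAlgebra.ι (stdForm N) v)
      = ExteriorAlgebra.ι ℝ v :=
    CliffordAlgebra.changeForm_ι CliffordAlgebra.changeForm.associated_neg_proof v
  change ExteriorAlgebra.ιInv (CliffordAlgebra.equivExterior (stdForm N)
    (CliffordAlgebra.ι (stdForm N) v)) = v
  rw [h, ExteriorAlgebra.ι_leftInverse]

/-- The rotation `v ↦ g v g⁻¹` of `ℝ^N` covered by `g : Spin N`. -/
def spinRot {N : ℕ} (g : Spin N) : Euc N →L[ℝ] Euc N :=
  LinearMap.toContinuousLinearMap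
    (vecPart N ∘ₗ LinearMap.mulRight ℝ ((g⁻¹ : Spin N) : Cl N) ∘ₗ
      LinearMap.mulLeft ℝ (g : Cl N) ∘ₗ CliffordAlgebra.ι (stdForm N))

theorem ι_spinRot {N : ℕ} (g : Spin N) (v : Euc N) :
    CliffordAlgebra.ι (stdForm N) (spinRot g v) =
      (g : Cl N) * CliffordAlgebra.ι (stdForm N) v * ((g⁻¹ : Spin N) : Cl N) := by
  let _ : Invertible (2 : ℝ) := invertibleOfNonzero two_ne_zero
  have h := spinGroup.conjAct_smul_ι_mem_range_ι (x := spinGroup.toUnits g)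
    (by simp) v
  rw [ConjAct.units_smul_def] at h
  obtain ⟨w, hw⟩ := h
  have hw' : CliffordAlgebra.ι (stdForm N) w =
      (g : Cl N) * CliffordAlgebra.ι (stdForm N) v * ((g⁻¹ : Spin N) : Cl N) := hw
  have : spinRot g v = w := by
    change vecPart N ((g : Cl N) * CliffordAlgebra.ι (stdForm N) v * ((g⁻¹ : Spin N) : Cl N)) = w
    rw [← hw', vecPart_ι]
  rw [this, hw']

theorem spinRot_norm {N : ℕ} (g : Spin N) (v : Euc N) : ‖spinRot g v‖ = ‖v‖ := by
  have h1 : ((g⁻¹ : Spin N) : Cl N) * (g : Cl N) = 1 := by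
    rw [← Submonoid.coe_mul, inv_mul_cancel, Submonoid.coe_one]
  have h2 : (g : Cl N) * ((g⁻¹ : Spin N) : Cl N) = 1 := by
    rw [← Submonoid.coe_mul, mul_inv_cancel, Submonoid.coe_one]
  have h3 : algebraMap ℝ (Cl N) (stdForm N (spinRot g v)) =
      algebraMap ℝ (Cl N) (stdForm N v) := by
    rw [← CliffordAlgebra.ι_sq_scalar, ι_spinRot]
    calc (g : Cl N) * CliffordAlgebra.ι (stdForm N) v * ((g⁻¹ : Spin N) : Cl N) *
          ((g : Cl N) * CliffordAlgebra.ι (stdForm N) v * ((g⁻¹ : Spin N) : Cl N))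
        = (g : Cl N) * CliffordAlgebra.ι (stdForm N) v *
          (((g⁻¹ : Spin N) : Cl N) * (g : Cl N)) * CliffordAlgebra.ι (stdForm N) v *
            ((g⁻¹ : Spin N) : Cl N) := by simp only [mul_assoc]
      _ = (g : Cl N) * (CliffordAlgebra.ι (stdForm N) v * CliffordAlgebra.ι (stdForm N) v) *
            ((g⁻¹ : Spin N) : Cl N) := by rw [h1, mul_one]; simp only [mul_assoc]
      _ = algebraMap ℝ (Cl N) (stdForm N v) := by
          rw [CliffordAlgebra.ι_sq_scalar, ← Algebra.commutes, mul_assoc, h2, mul_one]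
  let _ : Invertible (2 : ℝ) := invertibleOfNonzero two_ne_zero
  have h4 : stdForm N (spinRot g v) = stdForm N v := by
    have h5 := congrArg (CliffordAlgebra.equivExterior (stdForm N)) h3
    have h6 : ∀ r : ℝ, CliffordAlgebra.equivExterior (stdForm N) (algebraMap ℝ (Cl N) r) =
        algebraMap ℝ (ExteriorAlgebra ℝ (Euc N)) r := fun r =>
      CliffordAlgebra.changeForm_algebraMap CliffordAlgebra.changeForm.associated_neg_proof r
    rw [h6, h6] at h5
    exact (ExteriorAlgebra.algebraMap_leftInverse (R := ℝ) (Euc N)).injective h5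
  rw [stdForm_apply, stdForm_apply, neg_inj] at h4
  exact (sq_eq_sq₀ (norm_nonneg _) (norm_nonneg _)).1 h4

theorem spinRot_inner {N : ℕ} (g : Spin N) (v w : Euc N) :
    ⟪spinRot g v, spinRot g w⟫_ℝ = ⟪v, w⟫_ℝ :=
  LinearIsometry.inner_map_map
    (⟨(spinRot g : Euc N →ₗ[ℝ] Euc N), spinRot_norm g⟩ : Euc N →ₗᵢ[ℝ] Euc N) v w

/-! ### The standard bi-invariant Riemannian distance -/

/-- The speed at time `t` of a curve `γ : [0,1] → Spin N` for the bi-invariant Riemannian metric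
`-½ Tr (R⁻¹ dR ⊗ R⁻¹ dR)`, where `R` is the rotation covered by the group element. -/
def spinSpeed {N : ℕ} (γ : ℝ → Spin N) (t : ℝ) : ℝ :=
  let X : Euc N →ₗ[ℝ] Euc N :=
    ((spinRot (γ t)⁻¹).comp (derivWithin (fun s => spinRot (γ s)) (Icc 0 1) t) :
      Euc N →L[ℝ] Euc N)
  Real.sqrt (-(1 / 2) * LinearMap.trace ℝ (Euc N) (X ∘ₗ X))

/-- `γ : [0,1] → Spin N` is a `C¹` curve. As `g ↦ spinRot g` is a covering of the group of
rotations, the smooth structure of `Spin N` is the one pulled back from rotations. -/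
def IsC1Curve {N : ℕ} (γ : ℝ → Spin N) : Prop :=
  ContinuousOn γ (Icc 0 1) ∧ ContDiffOn ℝ 1 (fun s => spinRot (γ s)) (Icc 0 1)

/-- The Riemannian distance of `Spin N`: the infimum of the lengths of the `C¹` curves from `g`
to `h`. -/
def spinDist (N : ℕ) (g h : Spin N) : ℝ≥0∞ :=
  ⨅ (γ : ℝ → Spin N) (_ : IsC1Curve γ ∧ γ 0 = g ∧ γ 1 = h),
    ∫⁻ t in Icc (0 : ℝ) 1, ENNReal.ofReal (spinSpeed γ t)

/-- `S` is a smooth embedded submanifold of `Spin N` of codimension `k`: near each of its points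
it is the zero set of a smooth map to `ℝ^k` whose differential is onto at that point. Smooth maps
are written through the covering `spinRot` of the rotation group, whose tangent space at `R` is
`{R X : X skew-symmetric}`. -/
def IsSpinSubmanifold {N : ℕ} (k : ℕ) (S : Set (Spin N)) : Prop :=
  ∀ g ∈ S, ∃ U : Set (Spin N), IsOpen U ∧ g ∈ U ∧
    ∃ F : (Euc N →L[ℝ] Euc N) → Euc k,
      (∀ h ∈ U, ContDiffAt ℝ ∞ F (spinRot h)) ∧
      (∀ h ∈ U, h ∈ S ↔ F (spinRot h) = 0) ∧
      ∀ w : Euc k, ∃ X : Euc N →L[ℝ] Euc N, (∀ a b, ⟪X a, b⟫_ℝ = -⟪a, X b⟫_ℝ) ∧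
        fderiv ℝ F (spinRot g) ((spinRot g).comp X) = w

/-! ### `Spin(m)` as a subgroup of `Spin(m+2)` -/

/-- The inclusion `ℝ^m → ℝ^(m+1)`, `x ↦ (x, 0)`. -/
def pad (m : ℕ) : Euc m →ₗ[ℝ] Euc (m + 1) where
  toFun x := WithLp.toLp 2 (Fin.snoc (α := fun _ => ℝ) (fun i => x i) 0)
  map_add' x y := by
    ext i; refine Fin.lastCases ?_ (fun i => ?_) i <;> simp
  map_smul' c x := by
    ext i; refine Fin.lastCases ?_ (fun i => ?_) i <;> simp

theorem norm_pad {m : ℕ} (x : Euc m) : ‖pad m x‖ = ‖x‖ := by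
  simp [pad, EuclideanSpace.norm_eq, Fin.sum_univ_castSucc]

/-- The isometric inclusion `ℝ^m → ℝ^(m+2)`, `x ↦ (x, 0, 0)`. -/
def padIsometry (m : ℕ) : stdForm m →qᵢ stdForm (m + 2) where
  toLinearMap := pad (m + 1) ∘ₗ pad m
  map_app' x := by
    change stdForm (m + 2) (pad (m + 1) (pad m x)) = stdForm m x
    rw [stdForm_apply, stdForm_apply, norm_pad, norm_pad]

theorem star_map_isometry {m N : ℕ} (f : stdForm m →qᵢ stdForm N) (x : Cl m) :
    star (CliffordAlgebra.map f x) = CliffordAlgebra.map f (star x) := by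
  induction x using CliffordAlgebra.induction with
  | algebraMap r => simp only [AlgHom.commutes, CliffordAlgebra.star_algebraMap]
  | ι v => simp only [CliffordAlgebra.map_apply_ι, CliffordAlgebra.star_ι, map_neg]
  | mul a b ha hb => rw [map_mul, star_mul, star_mul, map_mul, ha, hb]
  | add a b ha hb => rw [map_add, star_add, star_add, map_add, ha, hb]

theorem map_mem_spinGroup {m N : ℕ} (f : stdForm m →qᵢ stdForm N) {x : Cl m}
    (hx : x ∈ spinGroup (stdForm m)) : CliffordAlgebra.map f x ∈ spinGroup (stdForm N) := by
  obtain ⟨⟨⟨y, hy, rfl⟩, hu⟩, he⟩ := hx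
  refine ⟨⟨⟨Units.map (CliffordAlgebra.map f : Cl m →* Cl N) y, ?_, rfl⟩, ?_⟩, ?_⟩
  · have hle : lipschitzGroup (stdForm m) ≤ (lipschitzGroup (stdForm N)).comap
        (Units.map (CliffordAlgebra.map f : Cl m →* Cl N)) := by
      refine (Subgroup.closure_le _).2 ?_
      rintro z ⟨v, hv⟩
      refine Subgroup.subset_closure ⟨f v, ?_⟩
      rw [← CliffordAlgebra.map_apply_ι, hv]
      rfl
    exact hle hy
  · replace hu := Unitary.mem_iff.1 hu
    refine Unitary.mem_iff.2 ?_
    rw [star_map_isometry, ← map_mul, ← map_mul]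
    exact ⟨by rw [hu.1, map_one], by rw [hu.2, map_one]⟩
  · refine CliffordAlgebra.even_induction (stdForm m)
      (motive := fun z _ => CliffordAlgebra.map f z ∈ CliffordAlgebra.even (stdForm N))
      ?_ ?_ ?_ _ he
    · intro r
      rw [AlgHom.commutes]
      exact Subalgebra.algebraMap_mem _ r
    · intro a b _ _ ha hb
      rw [map_add]
      exact add_mem ha hb
    · intro v w a _ ha
      rw [map_mul, map_mul, CliffordAlgebra.map_apply_ι, CliffordAlgebra.map_apply_ι]
      exact mul_mem (CliffordAlgebra.ι_mul_ι_mem_evenOdd_zero _ _ _) ha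

/-- The standard inclusion `Spin(m) → Spin(m+2)`. -/
def spinIncl (m : ℕ) : Spin m →* Spin (m + 2) where
  toFun g := ⟨CliffordAlgebra.map (padIsometry m) (g : Cl m), map_mem_spinGroup _ g.2⟩
  map_one' := Subtype.ext (map_one _)
  map_mul' _ _ := Subtype.ext (map_mul _ _ _)

/-! ### The fibration of `Spin(m+2)` -/

/-- `π : G → B` is, over the open set `U ⊆ B`, a principal bundle with structure group `H`, which
acts on `G` by right translations through `i : H → G`; over all of `B` its fibres are the cosets
of `H`, so that `π` identifies `G / H` with `B` as a set. -/
structure IsPrincipalBundleOver {G H B : Type} [Group G] [TopologicalSpace G] [Group H]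
    [TopologicalSpace H] [TopologicalSpace B] (i : H →* G) (π : G → B) (U : Set B) : Prop where
  isClosedEmbedding : IsClosedEmbedding i
  surjective : Function.Surjective π
  fiber_eq : ∀ g g' : G, π g = π g' ↔ ∃ h : H, g' = g * i h
  isOpen : IsOpen U
  continuousOn : ContinuousOn π (π ⁻¹' U)
  locallyTrivial : ∀ b ∈ U, ∃ e : Bundle.Trivialization H π, b ∈ e.baseSet ∧ e.baseSet ⊆ U ∧
    ∀ g ∈ e.source, ∀ h : H, e (g * i h) = ((e g).1, (e g).2 * h)

/-- The Stiefel manifold of orthonormal pairs of vectors of `ℝ^N`. -/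
abbrev Stiefel (N : ℕ) : Type :=
  {q : USphere N × USphere N // ⟪(q.1 : Euc N), (q.2 : Euc N)⟫_ℝ = 0}

/-- The last vector of the canonical basis of `ℝ^(m+1)`. -/
def pole (m : ℕ) : USphere (m + 1) :=
  ⟨EuclideanSpace.single (Fin.last m) 1, by simp⟩

/-- The projection `Spin(m+2) → Spin(m+2)/Spin(m)`: it takes `g` to the images under the rotation
of the last two basis vectors (in the order last, last but one). -/
def frameProj (m : ℕ) (g : Spin (m + 2)) : Stiefel (m + 2) :=
  ⟨(⟨spinRot g (pole (m + 1)), by simp [spinRot_norm]⟩,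
    ⟨spinRot g (pad (m + 1) (pole m)), by simp [spinRot_norm, norm_pad]⟩), by
      simp [spinRot_inner, pole, pad, EuclideanSpace.inner_single_left]⟩

/-- The vector of `p^⊥ = ℝ^(m+1)`, `p` the pole of `ℝ^(m+2)`, that corresponds to the vector `y`
of `x^⊥` under the rotation of the plane of `p` and `x` which takes `x` to `p`; for `x = -p`,
where there is no such plane, it is `y` itself (the division by zero returns zero). -/
def rotateBack (m : ℕ) (x y : Euc (m + 2)) : Euc (m + 1) :=
  let p : Euc (m + 2) := pole (m + 1)
  let w : Euc (m + 2) := y - (⟪p, y⟫_ℝ / (1 + ⟪p, x⟫_ℝ)) • (x + p)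
  WithLp.toLp 2 fun j => w j.castSucc

theorem norm_rotateBack {m : ℕ} (q : Stiefel (m + 2)) :
    ‖rotateBack m q.1.1 q.1.2‖ = 1 := by
  obtain ⟨⟨⟨x, hx⟩, ⟨y, hy⟩⟩, hxy⟩ := q
  simp only [mem_sphere_iff_norm, sub_zero] at hx hy
  change ⟪x, y⟫_ℝ = 0 at hxy
  change ‖rotateBack m x y‖ = 1
  obtain ⟨p, hp⟩ : ∃ p : Euc (m + 2), p = pole (m + 1) := ⟨_, rfl⟩
  obtain ⟨w, hw⟩ : ∃ w : Euc (m + 2), w = y - (⟪p, y⟫_ℝ / (1 + ⟪p, x⟫_ℝ)) • (x + p) := ⟨_, rfl⟩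
  have hpn : ‖p‖ = 1 := by rw [hp]; simp [pole]
  have hpx : ‖x + p‖ ^ 2 = 2 * (1 + ⟪p, x⟫_ℝ) := by
    rw [norm_add_sq_real, hx, hpn, real_inner_comm]; ring
  have hxx : ⟪p, p⟫_ℝ = 1 := by rw [real_inner_self_eq_norm_sq, hpn]; norm_num
  have key : ‖w‖ = 1 ∧ ⟪p, w⟫_ℝ = 0 := by
    rcases eq_or_ne (1 + ⟪p, x⟫_ℝ) 0 with h0 | h0
    · have hz : x + p = 0 := by
        rw [h0, mul_zero] at hpx
        exact norm_eq_zero.1 (pow_eq_zero_iff two_ne_zero |>.1 hpx)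
      have hpe : p = -x := (neg_eq_of_add_eq_zero_right hz).symm
      have hwy : w = y := by rw [hw, hz, smul_zero, sub_zero]
      rw [hwy]
      exact ⟨hy, by rw [hpe, inner_neg_left, hxy, neg_zero]⟩
    · constructor
      · have : ‖w‖ ^ 2 = 1 := by
          rw [hw, norm_sub_sq_real, norm_smul, mul_pow, hpx, hy, real_inner_smul_right,
            inner_add_right, real_inner_comm x y, hxy, real_inner_comm p y, Real.norm_eq_abs,
            sq_abs]
          field_simp
          ring
        exact (pow_eq_one_iff_of_nonneg (norm_nonneg _) two_ne_zero).1 this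
      · rw [hw, inner_sub_right, real_inner_smul_right, inner_add_right, hxx]
        field_simp
        ring
  have hlast : w (Fin.last (m + 1)) = 0 := by
    have := key.2
    rw [hp] at this
    simpa [pole, EuclideanSpace.inner_single_left] using this
  have hr : rotateBack m x y = WithLp.toLp 2 fun j : Fin (m + 1) => w j.castSucc := by
    rw [hw, hp]; rfl
  have hn : ‖rotateBack m x y‖ = ‖w‖ := by
    rw [hr, EuclideanSpace.norm_eq, EuclideanSpace.norm_eq, Fin.sum_univ_castSucc (n := m + 1),
      hlast]
    simp
  rw [hn, key.1]

/-- The identification `Spin(m+2)/Spin(m) ≡ S^(m+1) × S^m`: `(x, y)` is sent to `x` and to the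
vector of the fixed sphere `S^m ⊆ p^⊥` obtained from `y ∈ x^⊥` by the rotation taking `x` to the
pole `p`. It is a bijection, and bicontinuous away from `x = -p`. -/
def frameToProduct (m : ℕ) (q : Stiefel (m + 2)) : USphere (m + 2) × USphere (m + 1) :=
  (q.1.1, ⟨rotateBack m q.1.1 q.1.2, by simp [norm_rotateBack]⟩)

/-- The projection of `Spin(m+2)` to `S^(m+1) × S^m`. -/
def baseProj (m : ℕ) (g : Spin (m + 2)) : USphere (m + 2) × USphere (m + 1) :=
  frameToProduct m (frameProj m g)

/-- The product of spheres without the fibre over the antipode of the pole. -/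
def regularBase (m : ℕ) : Set (USphere (m + 2) × USphere (m + 1)) :=
  {b | b.1 ≠ -pole (m + 1)}

/-- The equator of the unit sphere orthogonal to `u`. -/
def equator {N : ℕ} (u : USphere N) : Set (USphere N) :=
  {x | ⟪(u : Euc N), (x : Euc N)⟫_ℝ = 0}

/-! ### Concentration of measure on a family of subsets -/

/-- The open tubular neighbourhood of radius `r` of `S` for the distance `d`. -/
def tube {X : Type} (d : X → X → ℝ≥0∞) (S : Set X) (r : ℝ) : Set X :=
  {x | ∃ s ∈ S, d x s < ENNReal.ofReal r}

/-- Metric concentration: `X n`, `n = 1, 2, …`, are connected spaces with distances `d n` and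
normalised measures `μ n` that are positive on the non-empty open sets, the `S n` are proper
closed subsets, and for some radii `ε n > 0` that tend to zero the measure of the complement of
the tubular neighbourhood of `S n` of radius `ε n` tends to zero. -/
structure ConcentratesOn (X : ℕ → Type) [∀ n, TopologicalSpace (X n)]
    [∀ n, MeasurableSpace (X n)] (d : ∀ n, X n → X n → ℝ≥0∞) (μ : ∀ n, Measure (X n))
    (S : ∀ n, Set (X n)) : Prop where
  connected : ∀ n, 1 ≤ n → ConnectedSpace (X n)
  normalised : ∀ n, 1 ≤ n → IsProbabilityMeasure (μ n)
  openPos : ∀ n, 1 ≤ n → (μ n).IsOpenPosMeasure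
  closed : ∀ n, 1 ≤ n → IsClosed (S n)
  proper : ∀ n, 1 ≤ n → S n ≠ univ
  concentrates : ∃ ε : ℕ → ℝ, (∀ n, 0 < ε n) ∧ Tendsto ε atTop (𝓝 0) ∧
    Tendsto (fun n => μ n (tube (d n) (S n) (ε n))ᶜ) atTop (𝓝 0)

/-- The normalised bi-invariant measures on a group. -/
structure IsNormalisedInvariant {G : Type} [Group G] [MeasurableSpace G] (μ : Measure G) :
    Prop where
  isProbabilityMeasure : IsProbabilityMeasure μ
  isMulLeftInvariant : μ.IsMulLeftInvariant
  isMulRightInvariant : μ.IsMulRightInvariant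

end

noncomputable section

open CliffordAlgebra

/-! ### The Clifford algebra -/

/-! Concentration rests on second moments alone. Put N = 2n + 2. For a Haar-random rotation and unit
vectors a, b, the entry ⟨a, R b⟩ has mean square 1/N: the N coordinates of R b have squares adding
to 1, and by invariance they have equal means. By Chebyshev, each of four chosen entries is smaller
than δ except on a set of measure at most 1/(N δ²). When all four are small, two successive plane
rotations by angles O(δ) carry g into the preimage of the bi-equator
(`mem_tube_preimage_biequator`), and an explicit curve shows that the distance travelled is O(δ)
(`spinDist_rotor_mul_rotor_mul_le`). The choice δ = N^(-1/4) makes both the radius and the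
exceptional measure tend to zero.

The algebra rests on Cartan–Dieudonné and on the fact that the twisted centre of the Clifford
algebra consists of scalars. A spin element that covers a product of reflections is therefore plus
or minus the corresponding product of unit vectors (`Spin.eq_or_eq_neg_vecProd`). This gives
compactness and connectedness, as the group is a fixed power of the set of products of two unit
vectors (`spinGroup_eq_pow`), and it identifies the stabiliser of the last two basis vectors with
the smaller spin group (`exists_spinIncl_eq`). Local sections are products of the elements `turn`,
which rotate one unit vector to another and depend continuously on both away from antipodal pairs; a
section together with the coset description of the fibres yields a trivialization.

The fibre over x = -p is null because all fibres over points of the sphere have equal measure, and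
infinitely many disjoint ones fit into a probability space. The submanifold claim uses the two
equations of the bi-equator, whose differential is triangular with unit diagonal on two explicit
infinitesimal rotations. -/

theorem stdForm_polar {N : ℕ} (v w : Euc N) :
    QuadraticMap.polar (stdForm N) v w = -(2 * ⟪v, w⟫_ℝ) := by
  rw [QuadraticMap.polar, stdForm_apply, stdForm_apply, stdForm_apply, norm_add_sq_real]
  ring

theorem ι_mul_swap {N : ℕ} (v w : Euc N) :
    ι (stdForm N) v * ι (stdForm N) w =
      -(ι (stdForm N) w * ι (stdForm N) v) - algebraMap ℝ (Cl N) (2 * ⟪v, w⟫_ℝ) := by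
  have h := ι_mul_ι_add_swap (Q := stdForm N) v w
  rw [stdForm_polar, map_neg] at h
  rw [eq_sub_of_add_eq h]
  abel

/-- The `k`-th vector of the canonical basis of `ℝ^N`, or zero if there is none. -/
def coordVec (N k : ℕ) : Euc N :=
  if h : k < N then EuclideanSpace.single ⟨k, h⟩ 1 else 0

/-- The span of the products of distinct vectors among the first `k` canonical basis vectors. -/
def coordFilt (N : ℕ) : ℕ → Submodule ℝ (Cl N)
  | 0 => Submodule.span ℝ {1}
  | k + 1 => coordFilt N k ⊔
      (coordFilt N k).map (LinearMap.mulLeft ℝ (ι (stdForm N) (coordVec N k)))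

theorem coordFilt_fg (N k : ℕ) : (coordFilt N k).FG := by
  induction k with
  | zero => exact Submodule.fg_span_singleton _
  | succ k ih => exact ih.sup (ih.map _)

theorem mem_coordFilt_succ {N k : ℕ} {x : Cl N} : x ∈ coordFilt N (k + 1) ↔
    ∃ a ∈ coordFilt N k, ∃ b ∈ coordFilt N k, x = a + ι (stdForm N) (coordVec N k) * b := by
  simp only [coordFilt, Submodule.mem_sup, Submodule.mem_map, LinearMap.mulLeft_apply]
  constructor
  · rintro ⟨a, ha, _, ⟨b, hb, rfl⟩, rfl⟩
    exact ⟨a, ha, b, hb, rfl⟩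
  · rintro ⟨a, ha, b, hb, rfl⟩
    exact ⟨a, ha, _, ⟨b, hb, rfl⟩, rfl⟩

theorem algebraMap_mul_mem_coordFilt {N k : ℕ} (r : ℝ) {x : Cl N} (hx : x ∈ coordFilt N k) :
    algebraMap ℝ (Cl N) r * x ∈ coordFilt N k := by
  rw [← Algebra.smul_def]
  exact Submodule.smul_mem _ _ hx

/-- A new factor is moved inwards by anticommutation until it meets its own copy, where it squares
to a scalar. Hence the last stage is a left ideal containing 1, that is, everything, and the algebra
is finite-dimensional. -/
theorem ι_coordVec_mul_mem {N k j : ℕ} (hj : j < k) {x : Cl N} (hx : x ∈ coordFilt N k) :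
    ι (stdForm N) (coordVec N j) * x ∈ coordFilt N k := by
  induction k generalizing x with
  | zero => omega
  | succ k ih =>
    obtain ⟨a, ha, b, hb, rfl⟩ := mem_coordFilt_succ.1 hx
    rcases Nat.lt_succ_iff_lt_or_eq.1 hj with h | rfl
    · refine mem_coordFilt_succ.2 ⟨ι (stdForm N) (coordVec N j) * a -
        algebraMap ℝ (Cl N) (2 * ⟪coordVec N j, coordVec N k⟫_ℝ) * b, ?_,
        -(ι (stdForm N) (coordVec N j) * b), neg_mem (ih h hb), ?_⟩
      · exact sub_mem (ih h ha) (algebraMap_mul_mem_coordFilt _ hb)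
      · rw [mul_add, ← mul_assoc, ι_mul_swap, sub_mul]
        simp only [mul_neg, neg_mul, mul_assoc]
        abel
    · refine mem_coordFilt_succ.2
        ⟨algebraMap ℝ (Cl N) (stdForm N (coordVec N j)) * b,
        algebraMap_mul_mem_coordFilt _ hb, a, ha, ?_⟩
      rw [mul_add, ← mul_assoc, ι_sq_scalar, add_comm]

theorem coordFilt_self (N : ℕ) : coordFilt N N = ⊤ := by
  refine Submodule.eq_top_iff'.2 fun x => ?_
  have hone : ∀ k, (1 : Cl N) ∈ coordFilt N k := by
    intro k
    induction k with
    | zero => exact Submodule.mem_span_singleton_self _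
    | succ k ih => exact Submodule.mem_sup_left ih
  induction x using CliffordAlgebra.left_induction with
  | algebraMap r => rw [← mul_one (algebraMap ℝ (Cl N) r)]
                    exact algebraMap_mul_mem_coordFilt _ (hone N)
  | add x y hx hy => exact add_mem hx hy
  | ι_mul x v hx =>
    have hv : v = ∑ i : Fin N, v i • coordVec N i := by
      ext j
      simp [coordVec, Finset.sum_apply, Pi.single_apply]
    rw [hv, map_sum, Finset.sum_mul]
    refine sum_mem fun i _ => ?_
    rw [map_smul, smul_mul_assoc]
    exact Submodule.smul_mem _ _ (ι_coordVec_mul_mem i.2 hx)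

instance Cl.instFinite (N : ℕ) : Module.Finite ℝ (Cl N) :=
  ⟨by rw [← coordFilt_self N]; exact coordFilt_fg N N⟩

theorem contractLeft_eq_zero_of_mem_coordFilt {N k j : ℕ} (hjk : k ≤ j) {x : Cl N}
    (hx : x ∈ coordFilt N k) :
    contractLeft (innerₗ (Euc N) (coordVec N j)) x = 0 := by
  induction k generalizing x with
  | zero =>
    obtain ⟨r, rfl⟩ := Submodule.mem_span_singleton.1 hx
    rw [← Algebra.algebraMap_eq_smul_one, contractLeft_algebraMap]
  | succ k ih =>
    obtain ⟨a, ha, b, hb, rfl⟩ := mem_coordFilt_succ.1 hx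
    have h0 : ⟪coordVec N j, coordVec N k⟫_ℝ = 0 := by
      unfold coordVec
      split_ifs with h1 h2
      · rw [EuclideanSpace.inner_single_left, PiLp.single_apply,
          if_neg (by rw [Fin.mk.injEq]; omega)]
        simp
      · exact inner_zero_right _
      · exact inner_zero_left _
      · exact inner_zero_left _
    rw [map_add, contractLeft_ι_mul, ih (by omega) ha, ih (by omega) hb, innerₗ_apply_apply, h0]
    simp

/-- The basis vectors are stripped off from the last to the first: in x = a + e_j b, with a and b
free of e_j, contraction with e_j returns b, which must therefore vanish. -/
theorem exists_algebraMap_of_contractLeft {N : ℕ} (x : Cl N)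
    (hx : ∀ v : Euc N, contractLeft (innerₗ (Euc N) v) x = 0) :
    ∃ r : ℝ, x = algebraMap ℝ (Cl N) r := by
  have key : ∀ k ≤ N, x ∈ coordFilt N (N - k) := by
    intro k
    induction k with
    | zero => intro _; rw [Nat.sub_zero, coordFilt_self]; trivial
    | succ k ih =>
      intro hk
      have h1 := ih (by omega)
      obtain ⟨j, hj⟩ : ∃ j, N - k = j + 1 := ⟨N - k - 1, by omega⟩
      rw [hj] at h1
      have h2 : N - (k + 1) = j := by omega
      rw [h2]
      obtain ⟨a, ha, b, hb, rfl⟩ := mem_coordFilt_succ.1 h1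
      have h3 := hx (coordVec N j)
      have h4 : ⟪coordVec N j, coordVec N j⟫_ℝ = 1 := by
        have : j < N := by omega
        simp [coordVec, this]
      rw [map_add, contractLeft_ι_mul, contractLeft_eq_zero_of_mem_coordFilt le_rfl ha,
        contractLeft_eq_zero_of_mem_coordFilt le_rfl hb, innerₗ_apply_apply, h4] at h3
      have h5 : b = 0 := by simpa using h3
      rw [h5, mul_zero, add_zero]
      exact ha
  have h0 := key N le_rfl
  rw [Nat.sub_self] at h0
  obtain ⟨r, rfl⟩ := Submodule.mem_span_singleton.1 h0
  exact ⟨r, (Algebra.algebraMap_eq_smul_one r).symm⟩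

/-- Both sides are twisted derivations in x that agree on vectors. The identity turns twisted
commutation with v into vanishing of the contraction by v. -/
theorem ι_mul_sub_involute_mul {N : ℕ} (v : Euc N) (x : Cl N) :
    ι (stdForm N) v * x - involute x * ι (stdForm N) v =
      -(2 : ℝ) • contractLeft (innerₗ (Euc N) v) x := by
  induction x using CliffordAlgebra.left_induction with
  | algebraMap r => simp [Algebra.commutes]
  | add x y hx hy =>
    rw [map_add, map_add, smul_add, ← hx, ← hy, mul_add, add_mul]
    abel
  | ι_mul x m hx =>
    rw [contractLeft_ι_mul, smul_sub, ← mul_smul_comm, ← hx, ← mul_assoc, ι_mul_swap,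
      map_mul involute, involute_ι, innerₗ_apply_apply, Algebra.algebraMap_eq_smul_one, smul_smul]
    simp only [mul_sub, sub_mul, neg_mul, smul_mul_assoc, one_mul, mul_assoc, neg_smul]
    abel

/-- The twisted centre of the Clifford algebra consists of the scalars. -/
theorem exists_algebraMap_of_twisted_comm {N : ℕ} (x : Cl N)
    (hx : ∀ v : Euc N, ι (stdForm N) v * x = involute x * ι (stdForm N) v) :
    ∃ r : ℝ, x = algebraMap ℝ (Cl N) r := by
  refine exists_algebraMap_of_contractLeft x fun v => ?_
  have h := ι_mul_sub_involute_mul v x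
  rw [hx v, sub_self] at h
  simpa using h.symm

theorem algebraMap_Cl_injective (N : ℕ) : Function.Injective (algebraMap ℝ (Cl N)) := by
  let _ : Invertible (2 : ℝ) := invertibleOfNonzero two_ne_zero
  intro a b h
  have h5 := congrArg (CliffordAlgebra.equivExterior (stdForm N)) h
  have h6 : ∀ r : ℝ, CliffordAlgebra.equivExterior (stdForm N) (algebraMap ℝ (Cl N) r) =
      algebraMap ℝ (ExteriorAlgebra ℝ (Euc N)) r := fun r =>
    CliffordAlgebra.changeForm_algebraMap CliffordAlgebra.changeForm.associated_neg_proof r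
  rw [h6, h6] at h5
  exact (ExteriorAlgebra.algebraMap_leftInverse (R := ℝ) (Euc N)).injective h5

theorem ι_stdForm_injective (N : ℕ) : Function.Injective (ι (stdForm N)) :=
  fun a b h => by rw [← vecPart_ι a, h, vecPart_ι]

/-! ### Products of unit vectors -/

/-- The product of a list of vectors in the Clifford algebra. -/
def vecProd {N : ℕ} (l : List (Euc N)) : Cl N := (l.map (ι (stdForm N))).prod

/-- The reflection in the hyperplane orthogonal to the unit vector `v`. -/
def hyperRefl {N : ℕ} (v x : Euc N) : Euc N := x - (2 * ⟪v, x⟫_ℝ) • v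

@[simp] theorem vecProd_nil {N : ℕ} : vecProd ([] : List (Euc N)) = 1 := rfl

@[simp] theorem vecProd_cons {N : ℕ} (v : Euc N) (l : List (Euc N)) :
    vecProd (v :: l) = ι (stdForm N) v * vecProd l := by
  simp [vecProd]

theorem ι_unit_sq {N : ℕ} {v : Euc N} (hv : ‖v‖ = 1) :
    ι (stdForm N) v * ι (stdForm N) v = -1 := by
  rw [ι_sq_scalar, stdForm_apply, hv]
  simp

theorem ι_mul_ι_eq_hyperRefl {N : ℕ} {v : Euc N} (hv : ‖v‖ = 1) (x : Euc N) :
    ι (stdForm N) v * ι (stdForm N) x =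
      -(ι (stdForm N) (hyperRefl v x) * ι (stdForm N) v) := by
  rw [ι_mul_swap, hyperRefl, map_sub, map_smul, sub_mul, smul_mul_assoc, ι_unit_sq hv,
    Algebra.algebraMap_eq_smul_one, smul_neg]
  abel

theorem star_vecProd_mul_self {N : ℕ} {l : List (Euc N)} (hl : ∀ v ∈ l, ‖v‖ = 1) :
    star (vecProd l) * vecProd l = 1 := by
  induction l with
  | nil => simp
  | cons v l ih =>
    rw [vecProd_cons, star_mul, star_ι, mul_assoc, ← mul_assoc (-_), neg_mul,
      ι_unit_sq (hl v (by simp)), neg_neg, one_mul]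
    exact ih fun w hw => hl w (by simp [hw])

theorem vecProd_mul_star_self {N : ℕ} {l : List (Euc N)} (hl : ∀ v ∈ l, ‖v‖ = 1) :
    vecProd l * star (vecProd l) = 1 := by
  induction l with
  | nil => simp
  | cons v l ih =>
    have ih' := ih fun w hw => hl w (by simp [hw])
    rw [vecProd_cons, star_mul, star_ι, mul_assoc, ← mul_assoc (vecProd l), ih', one_mul,
      mul_neg, ι_unit_sq (hl v (by simp)), neg_neg]

theorem involute_vecProd {N : ℕ} (l : List (Euc N)) :
    involute (vecProd l) = (-1 : Cl N) ^ l.length * vecProd l := by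
  induction l with
  | nil => simp
  | cons v l ih =>
    rw [vecProd_cons, map_mul, involute_ι, ih, List.length_cons, pow_succ]
    rcases Nat.even_or_odd l.length with h | h <;> simp [h.neg_one_pow]

/-- Passing x across one unit vector replaces it by minus its reflection, so the sign counts the
factors. -/
theorem vecProd_mul_ι {N : ℕ} {l : List (Euc N)} (hl : ∀ v ∈ l, ‖v‖ = 1) (x : Euc N) :
    vecProd l * ι (stdForm N) x = (-1 : Cl N) ^ l.length *
      (ι (stdForm N) (l.foldr hyperRefl x) * vecProd l) := by
  induction l with
  | nil => simp
  | cons v l ih =>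
    have ih' := ih fun w hw => hl w (by simp [hw])
    rw [vecProd_cons, mul_assoc, ih', List.foldr_cons, List.length_cons, pow_succ]
    have h := ι_mul_ι_eq_hyperRefl (hl v (by simp)) (l.foldr hyperRefl x)
    rcases Nat.even_or_odd l.length with h' | h' <;>
      simp only [h'.neg_one_pow, one_mul, ← mul_assoc, h, neg_mul, mul_neg, mul_one, neg_neg]

theorem pairs_mem_spinGroup {N : ℕ} {u w : Euc N} (hu : ‖u‖ = 1) (hw : ‖w‖ = 1) :
    ι (stdForm N) u * ι (stdForm N) w ∈ spinGroup (stdForm N) := by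
  have hunit : ∀ v : Euc N, ‖v‖ = 1 → ∃ z ∈ lipschitzGroup (stdForm N),
      (z : Cl N) = ι (stdForm N) v := fun v hv =>
    ⟨⟨ι (stdForm N) v, -ι (stdForm N) v, by rw [mul_neg, ι_unit_sq hv, neg_neg],
      by rw [neg_mul, ι_unit_sq hv, neg_neg]⟩, Subgroup.subset_closure ⟨v, rfl⟩, rfl⟩
  obtain ⟨z, hz, hz'⟩ := hunit u hu
  obtain ⟨y, hy, hy'⟩ := hunit w hw
  have hl : ∀ v ∈ [u, w], ‖v‖ = 1 := by simp [hu, hw]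
  refine ⟨⟨⟨z * y, mul_mem hz hy, by rw [← hz', ← hy']; rfl⟩, ?_⟩, ι_mul_ι_mem_evenOdd_zero _ _ _⟩
  have h1 := star_vecProd_mul_self hl
  have h2 := vecProd_mul_star_self hl
  simp only [vecProd_cons, vecProd_nil, mul_one] at h1 h2
  exact Unitary.mem_iff.2 ⟨h1, h2⟩

theorem vecProd_mem_spinGroup {N : ℕ} (l : List (Euc N)) (hl : ∀ v ∈ l, ‖v‖ = 1)
    (he : Even l.length) : vecProd l ∈ spinGroup (stdForm N) := by
  match l, hl, he with
  | [], _, _ => exact one_mem _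
  | [v], _, he => simp at he
  | u :: w :: l, hl, he =>
    rw [vecProd_cons, vecProd_cons, ← mul_assoc]
    refine mul_mem (pairs_mem_spinGroup (hl u (by simp)) (hl w (by simp)))
      (vecProd_mem_spinGroup l (fun v hv => hl v (by simp [hv])) ?_)
    simpa [Nat.even_add_one] using he

/-! ### Rotations -/

theorem Spin.coe_inv_mul {N : ℕ} (g : Spin N) : ((g⁻¹ : Spin N) : Cl N) * (g : Cl N) = 1 := by
  rw [← Submonoid.coe_mul, inv_mul_cancel, Submonoid.coe_one]

theorem Spin.coe_mul_inv {N : ℕ} (g : Spin N) : (g : Cl N) * ((g⁻¹ : Spin N) : Cl N) = 1 := by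
  rw [← Submonoid.coe_mul, mul_inv_cancel, Submonoid.coe_one]

theorem Spin.coe_mul_ι {N : ℕ} (g : Spin N) (v : Euc N) :
    (g : Cl N) * ι (stdForm N) v = ι (stdForm N) (spinRot g v) * (g : Cl N) := by
  rw [ι_spinRot, mul_assoc, Spin.coe_inv_mul, mul_one]

theorem spinRot_eq_of_mul {N : ℕ} {g : Spin N} {v w : Euc N}
    (h : (g : Cl N) * ι (stdForm N) v = ι (stdForm N) w * (g : Cl N)) : spinRot g v = w := by
  apply ι_stdForm_injective N
  rw [ι_spinRot, h, mul_assoc, Spin.coe_mul_inv, mul_one]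

theorem spinRot_mul_apply {N : ℕ} (g h : Spin N) (v : Euc N) :
    spinRot (g * h) v = spinRot g (spinRot h v) := by
  apply spinRot_eq_of_mul
  rw [Submonoid.coe_mul, mul_assoc, Spin.coe_mul_ι, ← mul_assoc, Spin.coe_mul_ι, mul_assoc]

theorem spinRot_one_apply {N : ℕ} (v : Euc N) : spinRot (1 : Spin N) v = v := by
  apply spinRot_eq_of_mul
  simp

theorem spinRot_inv_apply_self {N : ℕ} (g : Spin N) (v : Euc N) :
    spinRot g⁻¹ (spinRot g v) = v := by
  rw [← spinRot_mul_apply, inv_mul_cancel, spinRot_one_apply]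

theorem spinRot_apply_inv_self {N : ℕ} (g : Spin N) (v : Euc N) :
    spinRot g (spinRot g⁻¹ v) = v := by
  rw [← spinRot_mul_apply, mul_inv_cancel, spinRot_one_apply]

theorem spinRot_mul {N : ℕ} (g h : Spin N) : spinRot (g * h) = (spinRot g).comp (spinRot h) :=
  ContinuousLinearMap.ext (spinRot_mul_apply g h)

/-- Elements of the spin group that cover a product of reflections. -/
theorem Spin.eq_or_eq_neg_vecProd {N : ℕ} (g : Spin N) {l : List (Euc N)}
    (hl : ∀ v ∈ l, ‖v‖ = 1) (hg : ∀ x, spinRot g x = l.foldr hyperRefl x) :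
    Even l.length ∧ ((g : Cl N) = vecProd l ∨ (g : Cl N) = -vecProd l) := by
  have hw1 := star_vecProd_mul_self hl
  have hw2 := vecProd_mul_star_self hl
  -- The parity of the inverse is deduced from the parity of the product by uniqueness of inverses.
  have hinv : involute (star (vecProd l)) = (-1 : Cl N) ^ l.length * star (vecProd l) := by
    have h1 : star (vecProd l) * involute (vecProd l) = (-1 : Cl N) ^ l.length := by
      rw [involute_vecProd]
      rcases Nat.even_or_odd l.length with h | h <;> simp [h.neg_one_pow, hw1]
    have h2 : involute (star (vecProd l)) * involute (vecProd l) = 1 := by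
      rw [← map_mul, hw1, map_one]
    have h3 : involute (vecProd l) * involute (star (vecProd l)) = 1 := by
      rw [← map_mul, hw2, map_one]
    calc involute (star (vecProd l))
        = (-1 : Cl N) ^ l.length * ((-1 : Cl N) ^ l.length * involute (star (vecProd l))) := by
          rw [← mul_assoc, ← pow_add, ← two_mul, pow_mul]; simp
      _ = (-1 : Cl N) ^ l.length * star (vecProd l) := by
          congr 1
          rw [← h1, mul_assoc, h3, mul_one]
  have hgi : involute (g : Cl N) = (g : Cl N) := spinGroup.involute_eq g.2
  -- With w the product of the list, w* g covers the identity, so it commutes with vectors up to the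
  -- parity sign of w. This is twisted commutation, because g is even.
  obtain ⟨r, hr⟩ := exists_algebraMap_of_twisted_comm (star (vecProd l) * (g : Cl N)) (by
    intro v
    have h1 := vecProd_mul_ι hl v
    have h2 : star (vecProd l) * ι (stdForm N) (spinRot g v) =
        (-1 : Cl N) ^ l.length * (ι (stdForm N) v * star (vecProd l)) := by
      rw [← hg] at h1
      have h3 : ι (stdForm N) (spinRot g v) =
          (-1 : Cl N) ^ l.length * (vecProd l * ι (stdForm N) v * star (vecProd l)) := by
        rw [h1, ← mul_assoc, ← mul_assoc, ← pow_add, ← two_mul, pow_mul, neg_one_sq, one_pow,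
          one_mul, mul_assoc, hw2, mul_one]
      rw [h3]
      rcases Nat.even_or_odd l.length with h | h <;>
        simp only [h.neg_one_pow, one_mul, neg_mul, mul_neg, ← mul_assoc, hw1]
    rw [map_mul, hgi, hinv, mul_assoc ((-1 : Cl N) ^ _ * _), Spin.coe_mul_ι, mul_assoc,
      ← mul_assoc (star _), h2]
    rcases Nat.even_or_odd l.length with h | h <;> simp [h.neg_one_pow, mul_assoc])
  have hgr : (g : Cl N) = algebraMap ℝ (Cl N) r * vecProd l := by
    rw [Algebra.commutes, ← hr, ← mul_assoc, hw2, one_mul]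
  have hr2 : r * r = 1 := by
    apply algebraMap_Cl_injective N
    have h1 : star (g : Cl N) * (g : Cl N) = 1 := spinGroup.star_mul_self_of_mem g.2
    rw [hgr, star_mul, star_algebraMap, mul_assoc, ← mul_assoc (algebraMap ℝ (Cl N) r), ← map_mul,
      Algebra.commutes, ← mul_assoc, hw1, one_mul] at h1
    rw [h1, map_one]
  have hr1 : r = 1 ∨ r = -1 := mul_self_eq_one_iff.1 hr2
  constructor
  -- For a list of odd length w* g would be odd, yet it is the nonzero scalar r.
  · by_contra hodd
    rw [Nat.not_even_iff_odd] at hodd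
    have h1 : involute (star (vecProd l) * (g : Cl N)) = -(star (vecProd l) * (g : Cl N)) := by
      rw [map_mul, hgi, hinv, hodd.neg_one_pow]; simp
    rw [hr, AlgHom.commutes, ← map_neg] at h1
    have := algebraMap_Cl_injective N h1
    rcases hr1 with h | h <;> rw [h] at this <;> norm_num at this
  · rcases hr1 with h | h
    · left; rw [hgr, h, map_one, one_mul]
    · right; rw [hgr, h, map_neg, map_one, neg_mul, one_mul]

/-- Every linear isometry of `ℝ^N` is a product of at most `N` reflections. -/
theorem exists_list_foldr_hyperRefl {N : ℕ} (φ : Euc N ≃ₗᵢ[ℝ] Euc N) :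
    ∃ l : List (Euc N), l.length ≤ N ∧ (∀ v ∈ l, ‖v‖ = 1) ∧
      ∀ x, φ x = l.foldr hyperRefl x := by
  obtain ⟨l, hl, rfl⟩ := φ.reflections_generate_dim
  rw [finrank_euclideanSpace_fin] at hl
  suffices h : ∀ l : List (Euc N), ∃ l' : List (Euc N), l'.length ≤ l.length ∧
      (∀ v ∈ l', ‖v‖ = 1) ∧
      ∀ x, (l.map fun v => (ℝ ∙ v)ᗮ.reflection).prod x = l'.foldr hyperRefl x by
    obtain ⟨l', h1, h2, h3⟩ := h l
    exact ⟨l', h1.trans hl, h2, h3⟩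
  intro l
  induction l with
  | nil => exact ⟨[], by simp⟩
  | cons v l ih =>
    obtain ⟨l', h1, h2, h3⟩ := ih
    -- A zero vector is allowed among the generating reflections; it gives the identity and is
    -- dropped. The others are normalised.
    rcases eq_or_ne v 0 with rfl | hv
    · refine ⟨l', h1.trans (by simp), h2, fun x => ?_⟩
      rw [List.map_cons, List.prod_cons, LinearIsometryEquiv.coe_mul, Function.comp_apply, h3]
      exact Submodule.reflection_mem_subspace_eq_self (by simp)
    · refine ⟨(‖v‖⁻¹ • v) :: l', by simpa using h1, ?_, fun x => ?_⟩
      · intro w hw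
        rcases List.mem_cons.1 hw with rfl | hw
        · rw [norm_smul, norm_inv, norm_norm, inv_mul_cancel₀ (norm_ne_zero_iff.2 hv)]
        · exact h2 w hw
      · rw [List.map_cons, List.prod_cons, LinearIsometryEquiv.coe_mul, Function.comp_apply,
          h3, List.foldr_cons]
        rw [hyperRefl, Submodule.reflection_orthogonal_apply,
          Submodule.reflection_singleton_apply, real_inner_smul_left, smul_smul]
        have : (‖v‖ : ℝ) ≠ 0 := norm_ne_zero_iff.2 hv
        simp only [RCLike.ofReal_real_eq_id, id]
        rw [neg_sub, sub_right_inj, ← smul_assoc]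
        congr 1
        simp only [nsmul_eq_mul]
        push_cast
        field_simp

/-! ### Topology of the spin groups -/

instance Cl.instIsModuleTopology (N : ℕ) : IsModuleTopology ℝ (Cl N) := ⟨rfl⟩

instance Cl.instIsTopologicalRing (N : ℕ) : IsTopologicalRing (Cl N) :=
  IsModuleTopology.isTopologicalRing ℝ (Cl N)

/-- Coordinates identify the Clifford algebra with a Euclidean space. -/
def clHomeomorph (N : ℕ) : Cl N ≃ₜ (Fin (Module.finrank ℝ (Cl N)) → ℝ) where
  toEquiv := (Module.finBasis ℝ (Cl N)).equivFun.toEquiv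
  continuous_toFun := IsModuleTopology.continuous_of_linearMap
    (Module.finBasis ℝ (Cl N)).equivFun.toLinearMap
  continuous_invFun := LinearMap.continuous_of_finiteDimensional
    (Module.finBasis ℝ (Cl N)).equivFun.symm.toLinearMap

instance Cl.instT2Space (N : ℕ) : T2Space (Cl N) :=
  (clHomeomorph N).symm.t2Space

theorem continuous_ι_stdForm (N : ℕ) : Continuous (ι (stdForm N)) :=
  LinearMap.continuous_of_finiteDimensional _

theorem continuous_vecPart (N : ℕ) : Continuous (vecPart N) :=
  IsModuleTopology.continuous_of_linearMap _

theorem continuous_star_Cl (N : ℕ) : Continuous (star : Cl N → Cl N) := by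
  have h : (star : Cl N → Cl N) =
      ((reverse (Q := stdForm N)) ∘ₗ (involute (Q := stdForm N)).toLinearMap : Cl N →ₗ[ℝ] Cl N) :=
    rfl
  rw [h]
  exact IsModuleTopology.continuous_of_linearMap _

instance Spin.instIsTopologicalGroup (N : ℕ) : IsTopologicalGroup (Spin N) where
  continuous_mul := continuous_mul
  continuous_inv := by
    refine continuous_induced_rng.2 ?_
    exact (continuous_star_Cl N).comp continuous_subtype_val

theorem spinRot_eq_vecPart {N : ℕ} (g : Spin N) (v : Euc N) :
    spinRot g v = vecPart N ((g : Cl N) * ι (stdForm N) v * ((g⁻¹ : Spin N) : Cl N)) := rfl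

theorem continuous_spinRot_apply (N : ℕ) :
    Continuous fun q : Spin N × Euc N => spinRot q.1 q.2 := by
  simp only [spinRot_eq_vecPart]
  have h1 : Continuous fun q : Spin N × Euc N => (q.1 : Cl N) :=
    continuous_subtype_val.comp continuous_fst
  have h2 : Continuous fun q : Spin N × Euc N => ι (stdForm N) q.2 :=
    (continuous_ι_stdForm N).comp continuous_snd
  have h3 : Continuous fun q : Spin N × Euc N => ((q.1⁻¹ : Spin N) : Cl N) :=
    continuous_subtype_val.comp continuous_fst.inv
  exact (continuous_vecPart N).comp ((h1.mul h2).mul h3)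

theorem Continuous.spinRot_apply {X : Type*} [TopologicalSpace X] {N : ℕ} {g : X → Spin N}
    {v : X → Euc N} (hg : Continuous g) (hv : Continuous v) :
    Continuous fun x => spinRot (g x) (v x) := by
  have h : Continuous fun x => (g x, v x) := hg.prodMk hv
  have h' := Continuous.comp (continuous_spinRot_apply N) h
  refine h'.congr fun x => ?_
  rw [Function.comp_apply]

/-- The products of two unit vectors in the Clifford algebra. -/
def unitPairs (N : ℕ) : Set (Cl N) :=
  range fun q : USphere N × USphere N => ι (stdForm N) q.1 * ι (stdForm N) q.2

theorem continuous_unitPairs (N : ℕ) : Continuous fun q : USphere N × USphere N =>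
    ι (stdForm N) q.1 * ι (stdForm N) q.2 :=
  ((continuous_ι_stdForm N).comp (continuous_subtype_val.comp continuous_fst)).mul
    ((continuous_ι_stdForm N).comp (continuous_subtype_val.comp continuous_snd))

theorem mul_mem_unitPairs {N : ℕ} {u w : Euc N} (hu : ‖u‖ = 1) (hw : ‖w‖ = 1) :
    ι (stdForm N) u * ι (stdForm N) w ∈ unitPairs N :=
  ⟨(⟨u, by simpa using hu⟩, ⟨w, by simpa using hw⟩), rfl⟩

theorem exists_unit_vec (N : ℕ) [NeZero N] : ∃ v : Euc N, ‖v‖ = 1 :=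
  ⟨EuclideanSpace.single 0 1, by simp⟩

theorem one_mem_unitPairs (N : ℕ) [NeZero N] : 1 ∈ unitPairs N := by
  obtain ⟨v, hv⟩ := exists_unit_vec N
  have h := mul_mem_unitPairs hv (w := -v) (by rwa [norm_neg])
  rwa [map_neg, mul_neg, ι_unit_sq hv, neg_neg] at h

theorem neg_one_mem_unitPairs (N : ℕ) [NeZero N] : -1 ∈ unitPairs N := by
  obtain ⟨v, hv⟩ := exists_unit_vec N
  have h := mul_mem_unitPairs hv hv
  rwa [ι_unit_sq hv] at h

open scoped Pointwise in
theorem vecProd_mem_unitPairs_pow {N : ℕ} (l : List (Euc N)) (hl : ∀ v ∈ l, ‖v‖ = 1)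
    (he : Even l.length) : vecProd l ∈ unitPairs N ^ (l.length / 2) := by
  match l, hl, he with
  | [], _, _ => simp
  | [v], _, he => simp at he
  | u :: w :: l, hl, he =>
    have h : (u :: w :: l).length / 2 = l.length / 2 + 1 := by
      simp only [List.length_cons]; omega
    rw [vecProd_cons, vecProd_cons, ← mul_assoc, h, pow_succ']
    refine Set.mul_mem_mul (mul_mem_unitPairs (hl u (by simp)) (hl w (by simp)))
      (vecProd_mem_unitPairs_pow l (fun v hv => hl v (by simp [hv])) ?_)
    simpa [Nat.even_add_one] using he

/-- The rotation covered by an element of the spin group, as a linear isometry. -/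
def spinIsometry {N : ℕ} (g : Spin N) : Euc N ≃ₗᵢ[ℝ] Euc N :=
  LinearIsometry.toLinearIsometryEquiv
    (⟨(spinRot g : Euc N →ₗ[ℝ] Euc N), spinRot_norm g⟩ : Euc N →ₗᵢ[ℝ] Euc N) rfl

-- An element is plus or minus a product of at most N unit vectors, hence of at most N / 2 pairs.
-- One further pair carries the sign, and since 1 is itself a pair the exponent can be raised to the
-- common value N + 1. Compactness and connectedness then pass from the sphere to the group.
open scoped Pointwise in
theorem spinGroup_eq_pow (N : ℕ) [NeZero N] :
    (spinGroup (stdForm N) : Set (Cl N)) = unitPairs N ^ (N + 1) := by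
  apply Subset.antisymm
  · intro x hx
    obtain ⟨l, hlN, hl, hφ⟩ := exists_list_foldr_hyperRefl (spinIsometry ⟨x, hx⟩)
    obtain ⟨he, hor⟩ := Spin.eq_or_eq_neg_vecProd ⟨x, hx⟩ hl fun x => hφ x
    have hmem := vecProd_mem_unitPairs_pow l hl he
    have hsub : unitPairs N ^ (l.length / 2 + 1) ⊆ unitPairs N ^ (N + 1) :=
      Set.pow_subset_pow_right (one_mem_unitPairs N) (by omega)
    apply hsub
    rw [pow_succ']
    rcases hor with h | h
    · change x = _ at h
      rw [h, ← one_mul (vecProd l)]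
      exact Set.mul_mem_mul (one_mem_unitPairs N) hmem
    · change x = _ at h
      rw [h, ← neg_one_mul (vecProd l)]
      exact Set.mul_mem_mul (neg_one_mem_unitPairs N) hmem
  · have h : ∀ k : ℕ, unitPairs N ^ k ⊆ (spinGroup (stdForm N) : Set (Cl N)) := by
      intro k
      induction k with
      | zero => rw [pow_zero, Set.one_subset]; exact one_mem _
      | succ k ih =>
        rw [pow_succ]
        rintro _ ⟨a, ha, _, ⟨⟨u, w⟩, rfl⟩, rfl⟩
        exact mul_mem (ih ha) (pairs_mem_spinGroup (by simp) (by simp))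
    exact h _

open scoped Pointwise in
instance Spin.instCompactSpace (N : ℕ) [NeZero N] : CompactSpace (Spin N) := by
  refine isCompact_iff_compactSpace.1 (?_ : IsCompact (spinGroup (stdForm N) : Set (Cl N)))
  rw [spinGroup_eq_pow]
  have h1 : IsCompact (unitPairs N) := isCompact_range (continuous_unitPairs N)
  have h : ∀ k : ℕ, IsCompact (unitPairs N ^ k) := by
    intro k
    induction k with
    | zero => rw [pow_zero]; exact isCompact_singleton
    | succ k ih => rw [pow_succ]; exact ih.mul h1
  exact h _

theorem USphere.connectedSpace {N : ℕ} (hN : 2 ≤ N) : ConnectedSpace (USphere N) := by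
  refine isConnected_iff_connectedSpace.1 (isConnected_sphere ?_ 0 zero_le_one)
  rw [← Module.finrank_eq_rank, finrank_euclideanSpace_fin]
  exact_mod_cast hN

open scoped Pointwise in
theorem Spin.connectedSpace {N : ℕ} (hN : 2 ≤ N) : ConnectedSpace (Spin N) := by
  have : NeZero N := ⟨by omega⟩
  have := USphere.connectedSpace hN
  refine isConnected_iff_connectedSpace.1 (?_ : IsConnected (spinGroup (stdForm N) : Set (Cl N)))
  rw [spinGroup_eq_pow]
  have h1 : IsConnected (unitPairs N) := isConnected_range (continuous_unitPairs N)
  have h : ∀ k : ℕ, IsConnected (unitPairs N ^ k) := by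
    intro k
    induction k with
    | zero => rw [pow_zero]; exact isConnected_singleton
    | succ k ih =>
      rw [pow_succ, ← Set.image_mul_prod]
      exact (ih.prod h1).image _ continuous_mul.continuousOn
  exact h _

/-! ### Rotations that take one unit vector to another -/

theorem USphere.norm_coe {N : ℕ} (v : USphere N) : ‖(v : Euc N)‖ = 1 := norm_eq_of_mem_sphere v

theorem USphere.inner_self {N : ℕ} (v : USphere N) : ⟪(v : Euc N), (v : Euc N)⟫_ℝ = 1 := by
  rw [real_inner_self_eq_norm_sq, v.norm_coe, one_pow]

theorem USphere.abs_inner_le_one {N : ℕ} (a b : USphere N) :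
    |⟪(a : Euc N), (b : Euc N)⟫_ℝ| ≤ 1 :=
  (abs_real_inner_le_norm _ _).trans (by rw [a.norm_coe, b.norm_coe, mul_one])

theorem hyperRefl_of_inner_eq_zero {N : ℕ} {v x : Euc N} (h : ⟪v, x⟫_ℝ = 0) :
    hyperRefl v x = x := by
  simp [hyperRefl, h]

theorem hyperRefl_self {N : ℕ} (v : USphere N) : hyperRefl (v : Euc N) v = -v := by
  rw [hyperRefl, v.inner_self, mul_one, two_smul]
  abel

theorem hyperRefl_neg {N : ℕ} (v x : Euc N) : hyperRefl v (-x) = -hyperRefl v x := by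
  rw [hyperRefl, hyperRefl, inner_neg_right, mul_neg, neg_smul]
  abel

theorem hyperRefl_hyperRefl {N : ℕ} (v : USphere N) (x : Euc N) :
    hyperRefl (v : Euc N) (hyperRefl (v : Euc N) x) = x := by
  rw [hyperRefl, hyperRefl, inner_sub_right, inner_smul_right, v.inner_self]
  module

/-- The product of two unit vectors, as an element of the spin group. -/
def unitPair {N : ℕ} (u w : USphere N) : Spin N :=
  ⟨ι (stdForm N) u * ι (stdForm N) w, pairs_mem_spinGroup u.norm_coe w.norm_coe⟩

theorem continuous_unitPair (N : ℕ) :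
    Continuous fun q : USphere N × USphere N => unitPair q.1 q.2 :=
  (continuous_unitPairs N).subtype_mk _

theorem spinRot_unitPair {N : ℕ} (u w : USphere N) (x : Euc N) :
    spinRot (unitPair u w) x = hyperRefl (u : Euc N) (hyperRefl (w : Euc N) x) := by
  apply spinRot_eq_of_mul
  change ι (stdForm N) u * ι (stdForm N) w * ι (stdForm N) x =
    ι (stdForm N) (hyperRefl (u : Euc N) (hyperRefl (w : Euc N) x)) *
      (ι (stdForm N) u * ι (stdForm N) w)
  rw [mul_assoc, ι_mul_ι_eq_hyperRefl w.norm_coe, mul_neg, ← mul_assoc,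
    ι_mul_ι_eq_hyperRefl u.norm_coe, neg_mul, neg_neg, mul_assoc]

/-- The midpoint on the sphere of two unit vectors that are not opposite. -/
def midDir {N : ℕ} (v w : USphere N) : USphere N :=
  if h : (v : Euc N) + w = 0 then v else
    ⟨‖(v : Euc N) + w‖⁻¹ • ((v : Euc N) + w), by
      rw [mem_sphere_zero_iff_norm, norm_smul, norm_inv, norm_norm,
        inv_mul_cancel₀ (norm_ne_zero_iff.2 h)]⟩

theorem coe_midDir {N : ℕ} {v w : USphere N} (h : (v : Euc N) + w ≠ 0) :
    (midDir v w : Euc N) = ‖(v : Euc N) + w‖⁻¹ • ((v : Euc N) + w) := by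
  rw [midDir, dif_neg h]

theorem one_add_inner_ne_zero {N : ℕ} {v w : USphere N} (h : (v : Euc N) + w ≠ 0) :
    1 + ⟪(v : Euc N), (w : Euc N)⟫_ℝ ≠ 0 := by
  intro h0
  apply h
  have h1 : ‖(v : Euc N) + w‖ ^ 2 = 2 * (1 + ⟪(v : Euc N), (w : Euc N)⟫_ℝ) := by
    rw [norm_add_sq_real, v.norm_coe, w.norm_coe]; ring
  rw [h0, mul_zero] at h1
  exact norm_eq_zero.1 (pow_eq_zero_iff two_ne_zero |>.1 h1)

/-- Writing the reflection without square roots shows that the correction term in `rotateBack` is a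
reflection in disguise. -/
theorem hyperRefl_midDir {N : ℕ} {v w : USphere N} (h : (v : Euc N) + w ≠ 0) (x : Euc N) :
    hyperRefl (midDir v w : Euc N) x =
      x - (⟪(v : Euc N) + w, x⟫_ℝ / (1 + ⟪(v : Euc N), (w : Euc N)⟫_ℝ)) • ((v : Euc N) + w) := by
  have h1 : ‖(v : Euc N) + w‖ ^ 2 = 2 * (1 + ⟪(v : Euc N), (w : Euc N)⟫_ℝ) := by
    rw [norm_add_sq_real, v.norm_coe, w.norm_coe]; ring
  have h2 : ‖(v : Euc N) + w‖ ≠ 0 := norm_ne_zero_iff.2 h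
  have h3 := one_add_inner_ne_zero h
  rw [hyperRefl, coe_midDir h, smul_smul, real_inner_smul_left, sub_right_inj]
  congr 1
  field_simp
  rw [h1]
  ring

/-- The element of the spin group that covers the rotation taking `v` to `w` in their plane. -/
def turn {N : ℕ} (v w : USphere N) : Spin N := unitPair (midDir v w) v

/-- The reflection along v sends v to -v, and the one along the midpoint sends -v to w. -/
theorem spinRot_turn_self {N : ℕ} {v w : USphere N} (h : (v : Euc N) + w ≠ 0) :
    spinRot (turn v w) v = w := by
  have h3 := one_add_inner_ne_zero h
  rw [turn, spinRot_unitPair, hyperRefl_self, hyperRefl_neg, hyperRefl_midDir h, inner_add_left,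
    v.inner_self, real_inner_comm, div_self h3, one_smul]
  abel

theorem spinRot_turn_of_inner {N : ℕ} (v w : USphere N) {x : Euc N}
    (hx : ⟪(v : Euc N), x⟫_ℝ = 0) :
    spinRot (turn v w) x = hyperRefl (midDir v w : Euc N) x := by
  rw [turn, spinRot_unitPair, hyperRefl_of_inner_eq_zero hx]

theorem spinRot_turn_of_inner_of_inner {N : ℕ} {v w : USphere N} (h : (v : Euc N) + w ≠ 0)
    {x : Euc N} (hv : ⟪(v : Euc N), x⟫_ℝ = 0) (hw : ⟪(w : Euc N), x⟫_ℝ = 0) :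
    spinRot (turn v w) x = x := by
  rw [spinRot_turn_of_inner v w hv, hyperRefl_midDir h, inner_add_left, hv, hw]
  simp

theorem continuousOn_midDir (N : ℕ) :
    ContinuousOn (fun q : USphere N × USphere N => midDir q.1 q.2)
      {q | (q.1 : Euc N) + q.2 ≠ 0} := by
  have hs : Continuous fun q : USphere N × USphere N => (q.1 : Euc N) + q.2 :=
    (continuous_subtype_val.comp continuous_fst).add (continuous_subtype_val.comp continuous_snd)
  have h1 : ContinuousOn (fun q : USphere N × USphere N =>
      ‖(q.1 : Euc N) + q.2‖⁻¹ • ((q.1 : Euc N) + q.2)) {q | (q.1 : Euc N) + q.2 ≠ 0} :=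
    (hs.norm.continuousOn.inv₀ fun q hq => norm_ne_zero_iff.2 hq).smul hs.continuousOn
  rw [IsInducing.subtypeVal.continuousOn_iff]
  exact h1.congr fun q hq => coe_midDir hq

theorem continuousOn_turn (N : ℕ) : ContinuousOn (fun q : USphere N × USphere N => turn q.1 q.2)
    {q | (q.1 : Euc N) + q.2 ≠ 0} := by
  have h1 : ContinuousOn (fun q : USphere N × USphere N => (midDir q.1 q.2, q.1))
      {q | (q.1 : Euc N) + q.2 ≠ 0} :=
    (continuousOn_midDir N).prodMk continuous_fst.continuousOn
  have h2 := Continuous.comp_continuousOn (continuous_unitPair N) h1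
  refine h2.congr fun q _ => ?_
  rw [turn, Function.comp_apply]

theorem ContinuousOn.turn {X : Type*} [TopologicalSpace X] {N : ℕ} {v w : X → USphere N} {s : Set X}
    (hv : ContinuousOn v s) (hw : ContinuousOn w s)
    (h : ∀ a ∈ s, (v a : Euc N) + w a ≠ 0) : ContinuousOn (fun a => _root_.turn (v a) (w a)) s := by
  have h1 : ContinuousOn (fun a => (v a, w a)) s := hv.prodMk hw
  have h2 := ContinuousOn.comp (continuousOn_turn N) h1 h
  refine h2.congr fun a _ => ?_
  rw [Function.comp_apply]

/-- The action of the spin group on the unit sphere. -/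
def spinAct {N : ℕ} (g : Spin N) (v : USphere N) : USphere N :=
  ⟨spinRot g v, by simp [spinRot_norm]⟩

theorem coe_spinAct {N : ℕ} (g : Spin N) (v : USphere N) :
    (spinAct g v : Euc N) = spinRot g v := rfl

theorem continuous_spinAct (N : ℕ) :
    Continuous fun q : Spin N × USphere N => spinAct q.1 q.2 := by
  have h : Continuous fun q : Spin N × USphere N => (q.2 : Euc N) :=
    continuous_subtype_val.comp continuous_snd
  have h' : Continuous fun q : Spin N × USphere N => spinRot q.1 (q.2 : Euc N) :=
    Continuous.spinRot_apply continuous_fst h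
  exact h'.subtype_mk _

theorem ContinuousOn.spinAct {X : Type*} [TopologicalSpace X] {N : ℕ} {g : X → Spin N}
    {v : X → USphere N} {s : Set X} (hg : ContinuousOn g s) (hv : ContinuousOn v s) :
    ContinuousOn (fun a => _root_.spinAct (g a) (v a)) s := by
  have h1 : ContinuousOn (fun a => (g a, v a)) s := hg.prodMk hv
  have h2 := Continuous.comp_continuousOn (continuous_spinAct N) h1
  refine h2.congr fun a _ => ?_
  rw [Function.comp_apply]

/-! ### The inclusions of Euclidean spaces -/

theorem pad_castSucc {m : ℕ} (x : Euc m) (i : Fin m) : pad m x i.castSucc = x i := by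
  simp [pad]

theorem pad_last {m : ℕ} (x : Euc m) : pad m x (Fin.last m) = 0 := by
  simp [pad]

theorem inner_pad_pad {m : ℕ} (x y : Euc m) : ⟪pad m x, pad m y⟫_ℝ = ⟪x, y⟫_ℝ :=
  LinearIsometry.inner_map_map (⟨pad m, norm_pad⟩ : Euc m →ₗᵢ[ℝ] Euc (m + 1)) x y

theorem pad_injective (m : ℕ) : Function.Injective (pad m) :=
  (⟨pad m, norm_pad⟩ : Euc m →ₗᵢ[ℝ] Euc (m + 1)).injective

theorem inner_pole {m : ℕ} (x : Euc (m + 1)) :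
    ⟪(pole m : Euc (m + 1)), x⟫_ℝ = x (Fin.last m) := by
  simp [pole, EuclideanSpace.inner_single_left]

theorem inner_pole_pad {m : ℕ} (x : Euc m) : ⟪(pole m : Euc (m + 1)), pad m x⟫_ℝ = 0 := by
  rw [inner_pole, pad_last]

theorem inner_pad_pole {m : ℕ} (x : Euc m) : ⟪pad m x, (pole m : Euc (m + 1))⟫_ℝ = 0 := by
  rw [real_inner_comm, inner_pole_pad]

/-- Dropping the last coordinate. -/
def unpad (m : ℕ) : Euc (m + 1) →ₗ[ℝ] Euc m where
  toFun w := WithLp.toLp 2 fun j => w j.castSucc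
  map_add' _ _ := rfl
  map_smul' _ _ := rfl

theorem unpad_apply {m : ℕ} (x : Euc (m + 1)) (j : Fin m) : unpad m x j = x j.castSucc := rfl

theorem pad_unpad {m : ℕ} (x : Euc (m + 1)) :
    pad m (unpad m x) = x - ⟪(pole m : Euc (m + 1)), x⟫_ℝ • (pole m : Euc (m + 1)) := by
  rw [inner_pole]
  ext i
  refine Fin.lastCases ?_ (fun i => ?_) i
  · simp [pad_last, pole]
  · simp [pad_castSucc, unpad_apply, pole]

/-- The unit vector of `ℝ^(m+1)` that corresponds to a unit vector of `ℝ^m`. -/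
def padSphere {m : ℕ} (z : USphere m) : USphere (m + 1) :=
  ⟨pad m z, by simp [norm_pad]⟩

theorem coe_padSphere {m : ℕ} (z : USphere m) : (padSphere z : Euc (m + 1)) = pad m z := rfl

theorem continuous_pad (m : ℕ) : Continuous (pad m) := LinearMap.continuous_of_finiteDimensional _

theorem continuous_padSphere (m : ℕ) : Continuous (padSphere (m := m)) :=
  ((continuous_pad m).comp continuous_subtype_val).subtype_mk _

theorem pad_rotateBack {m : ℕ} {x y : USphere (m + 2)} (hxy : ⟪(x : Euc (m + 2)), y⟫_ℝ = 0) :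
    pad (m + 1) (rotateBack m x y) = (y : Euc (m + 2)) -
      (⟪(pole (m + 1) : Euc (m + 2)), y⟫_ℝ / (1 + ⟪(pole (m + 1) : Euc (m + 2)), x⟫_ℝ)) •
        ((x : Euc (m + 2)) + pole (m + 1)) := by
  change pad (m + 1) (unpad (m + 1) _) = _
  rw [pad_unpad, sub_eq_self]
  obtain ⟨p, hp⟩ : ∃ p : USphere (m + 2), p = pole (m + 1) := ⟨_, rfl⟩
  rw [← hp]
  rcases eq_or_ne ((p : Euc (m + 2)) + x) 0 with h0 | h0
  · have hx : (x : Euc (m + 2)) = -p := (neg_eq_of_add_eq_zero_right h0).symm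
    have hy : ⟪(p : Euc (m + 2)), y⟫_ℝ = 0 := by
      rw [hx, inner_neg_left, neg_eq_zero] at hxy
      exact hxy
    rw [add_comm (x : Euc (m + 2)), h0, smul_zero, sub_zero, hy, zero_smul]
  · have h3 := one_add_inner_ne_zero h0
    rw [inner_sub_right, real_inner_smul_right, inner_add_right, p.inner_self, add_comm _ (1 : ℝ),
      div_mul_cancel₀ _ h3, sub_self, zero_smul]

/-- The rotation from x back to p is the reflection along the midpoint followed by the one along p.
The first takes x^⊥ to p^⊥, where the second is the identity. -/
theorem pad_rotateBack_eq_hyperRefl {m : ℕ} {x y : USphere (m + 2)}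
    (hxy : ⟪(x : Euc (m + 2)), y⟫_ℝ = 0) (h : (pole (m + 1) : Euc (m + 2)) + x ≠ 0) :
    pad (m + 1) (rotateBack m x y) = hyperRefl (midDir (pole (m + 1)) x : Euc (m + 2)) y := by
  rw [pad_rotateBack hxy, hyperRefl_midDir h, inner_add_left, hxy, add_zero,
    add_comm (x : Euc (m + 2))]

/-! ### The frame map -/

theorem frameProj_fst {m : ℕ} (g : Spin (m + 2)) :
    ((frameProj m g).1.1 : Euc (m + 2)) = spinRot g (pole (m + 1)) := rfl

theorem frameProj_snd {m : ℕ} (g : Spin (m + 2)) :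
    ((frameProj m g).1.2 : Euc (m + 2)) = spinRot g (pad (m + 1) (pole m)) := rfl

theorem frameProj_eq_iff {m : ℕ} {g : Spin (m + 2)} {q : Stiefel (m + 2)} :
    frameProj m g = q ↔ spinRot g (pole (m + 1)) = q.1.1 ∧
      spinRot g (pad (m + 1) (pole m)) = q.1.2 := by
  rw [Subtype.ext_iff, Prod.ext_iff, Subtype.ext_iff, Subtype.ext_iff]
  rfl

theorem continuous_frameProj (m : ℕ) : Continuous (frameProj m) := by
  have h : ∀ v : Euc (m + 2), Continuous fun g : Spin (m + 2) => spinRot g v := fun v =>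
    Continuous.spinRot_apply continuous_id continuous_const
  exact (((h _).subtype_mk _).prodMk ((h _).subtype_mk _)).subtype_mk _

/-- The auxiliary f serves the antipodal case w = -v, where no plane is distinguished: a half-turn
in the plane of v and f is used. The fixing clause allows a second vector to be moved without
disturbing a first. -/
theorem exists_spinRot_eq {N : ℕ} {v w f : USphere N} (h : ⟪(v : Euc N), f⟫_ℝ = 0) :
    ∃ g : Spin N, spinRot g v = w ∧ ∀ x, ⟪(v : Euc N), x⟫_ℝ = 0 → ⟪(w : Euc N), x⟫_ℝ = 0 →
      ⟪(f : Euc N), x⟫_ℝ = 0 → spinRot g x = x := by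
  rcases eq_or_ne ((v : Euc N) + w) 0 with h0 | h0
  · refine ⟨unitPair f v, ?_, fun x h1 _ h3 => ?_⟩
    · rw [spinRot_unitPair, hyperRefl_self, hyperRefl_neg, hyperRefl_of_inner_eq_zero
        (by rw [real_inner_comm, h])]
      exact neg_eq_of_add_eq_zero_right h0
    · rw [spinRot_unitPair, hyperRefl_of_inner_eq_zero h1, hyperRefl_of_inner_eq_zero h3]
  · exact ⟨turn v w, spinRot_turn_self h0, fun x h1 h2 _ => spinRot_turn_of_inner_of_inner h0 h1 h2⟩

theorem frameProj_surjective {m : ℕ} (hm : 1 ≤ m) : Function.Surjective (frameProj m) := by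
  rintro ⟨⟨x, y⟩, hxy⟩
  have : NeZero m := ⟨by omega⟩
  obtain ⟨f, hf⟩ := exists_unit_vec m
  obtain ⟨g, hg, -⟩ := exists_spinRot_eq (v := pole (m + 1)) (w := x)
    (f := padSphere (pole m)) (inner_pole_pad _)
  -- The second vector is moved before g is applied. The spare direction is taken in ℝ^m, orthogonal
  -- to the pole, so that the pole stays fixed even in the antipodal case.
  obtain ⟨h, hh, hfix⟩ := exists_spinRot_eq (v := padSphere (pole m)) (w := spinAct g⁻¹ y)
    (f := padSphere (padSphere ⟨f, by simpa using hf⟩)) (by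
      rw [coe_padSphere, coe_padSphere, inner_pad_pad, coe_padSphere, inner_pole_pad])
  refine ⟨g * h, frameProj_eq_iff.2 ⟨?_, ?_⟩⟩
  · rw [spinRot_mul_apply, hfix, hg]
    · exact inner_pad_pole _
    · rw [← hxy, ← hg, ← spinRot_inner g⁻¹ _ (y : Euc (m + 2)), spinRot_inv_apply_self,
        real_inner_comm]
      rfl
    · exact inner_pad_pole _
  · rw [spinRot_mul_apply]
    change spinRot g (spinRot h (padSphere (pole m) : Euc (m + 2))) = y
    rw [hh, coe_spinAct, spinRot_apply_inv_self]

/-- Each generator anticommutes with p. On even elements the involution is trivial, so the included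
subgroup commutes with p and fixes it. -/
theorem map_mul_ι_of_inner {m N : ℕ} (f : stdForm m →qᵢ stdForm N) {p : Euc N}
    (hp : ∀ v, ⟪f v, p⟫_ℝ = 0) (x : Cl m) :
    CliffordAlgebra.map f x * ι (stdForm N) p =
      ι (stdForm N) p * CliffordAlgebra.map f (involute x) := by
  induction x using CliffordAlgebra.induction with
  | algebraMap r => simp only [AlgHom.commutes, Algebra.commutes]
  | ι v =>
    rw [involute_ι, map_neg, CliffordAlgebra.map_apply_ι, ι_mul_swap, hp v]
    simp
  | mul a b ha hb => rw [map_mul, map_mul, map_mul, mul_assoc, hb, ← mul_assoc, ha, mul_assoc]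
  | add a b ha hb => rw [map_add, map_add, map_add, add_mul, mul_add, ha, hb]

theorem coe_spinIncl {m : ℕ} (h : Spin m) :
    (spinIncl m h : Cl (m + 2)) = CliffordAlgebra.map (padIsometry m) (h : Cl m) := rfl

theorem padIsometry_apply {m : ℕ} (v : Euc m) : padIsometry m v = pad (m + 1) (pad m v) := rfl

theorem spinRot_spinIncl_of_inner {m : ℕ} (h : Spin m) {p : Euc (m + 2)}
    (hp : ∀ v, ⟪pad (m + 1) (pad m v), p⟫_ℝ = 0) : spinRot (spinIncl m h) p = p := by
  apply spinRot_eq_of_mul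
  rw [coe_spinIncl, map_mul_ι_of_inner _ hp, spinGroup.involute_eq h.2]

theorem spinRot_spinIncl_pad {m : ℕ} (h : Spin m) (v : Euc m) :
    spinRot (spinIncl m h) (pad (m + 1) (pad m v)) = pad (m + 1) (pad m (spinRot h v)) := by
  apply spinRot_eq_of_mul
  rw [coe_spinIncl, ← padIsometry_apply, ← padIsometry_apply, ← CliffordAlgebra.map_apply_ι,
    ← map_mul, Spin.coe_mul_ι, map_mul, CliffordAlgebra.map_apply_ι]

theorem spinIncl_injective (m : ℕ) : Function.Injective (spinIncl m) := by
  rw [injective_iff_map_eq_one]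
  intro g hg
  have h1 : ∀ v, spinRot g v = v := fun v => by
    have h := spinRot_spinIncl_pad g v
    rw [hg, spinRot_one_apply] at h
    exact (pad_injective _ (pad_injective _ h)).symm
  obtain ⟨-, h | h⟩ := Spin.eq_or_eq_neg_vecProd g (l := []) (by simp) (by simpa using h1)
  · exact Subtype.ext h
  · exfalso
    have h2 : (spinIncl m g : Cl (m + 2)) = 1 := by rw [hg]; rfl
    rw [coe_spinIncl, h, vecProd_nil, map_neg, map_one, ← map_one (algebraMap ℝ (Cl (m + 2))),
      ← map_neg] at h2
    have := algebraMap_Cl_injective _ h2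
    norm_num at this

theorem isClosedEmbedding_spinIncl (m : ℕ) [NeZero m] : IsClosedEmbedding (spinIncl m) := by
  refine Continuous.isClosedEmbedding ?_ (spinIncl_injective m)
  have h : Continuous (CliffordAlgebra.map (padIsometry m)) :=
    IsModuleTopology.continuous_of_linearMap (CliffordAlgebra.map (padIsometry m)).toLinearMap
  exact (h.comp continuous_subtype_val).subtype_mk _

theorem foldr_hyperRefl_map {m N : ℕ} (f : Euc m →ₗᵢ[ℝ] Euc N) (l : List (Euc m)) (x : Euc m)
    {r : Euc N} (hr : ∀ v, ⟪f v, r⟫_ℝ = 0) :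
    (l.map f).foldr hyperRefl (f x + r) = f (l.foldr hyperRefl x) + r := by
  induction l with
  | nil => rfl
  | cons v l ih =>
    rw [List.map_cons, List.foldr_cons, ih, List.foldr_cons, hyperRefl, inner_add_right, hr,
      add_zero, f.inner_map_map, hyperRefl, map_sub, map_smul]
    abel

theorem vecProd_map {m N : ℕ} (f : stdForm m →qᵢ stdForm N) (l : List (Euc m)) :
    vecProd (l.map f) = CliffordAlgebra.map f (vecProd l) := by
  induction l with
  | nil => simp
  | cons v l ih =>
    rw [List.map_cons, vecProd_cons, vecProd_cons, ih, map_mul, CliffordAlgebra.map_apply_ι]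

/-- The isometric inclusion `ℝ^m → ℝ^(m+2)`. -/
def padTwice (m : ℕ) : Euc m →ₗᵢ[ℝ] Euc (m + 2) :=
  ⟨pad (m + 1) ∘ₗ pad m, fun x => by
    rw [LinearMap.comp_apply, norm_pad, norm_pad]⟩

/-- The rotation restricts to an isometry of ℝ^m, which is a product of reflections. The same
vectors, padded by zeros, give reflections whose product is the whole rotation, so k is the included
product up to sign. -/
theorem exists_spinIncl_eq {m : ℕ} [NeZero m] {k : Spin (m + 2)}
    (h1 : spinRot k (pole (m + 1)) = pole (m + 1))
    (h2 : spinRot k (pad (m + 1) (pole m)) = pad (m + 1) (pole m)) :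
    ∃ h : Spin m, k = spinIncl m h := by
  have hdec : ∀ x : Euc (m + 2), ⟪(pole (m + 1) : Euc (m + 2)), x⟫_ℝ = 0 →
      ⟪pad (m + 1) (pole m), x⟫_ℝ = 0 → padTwice m (unpad m (unpad (m + 1) x)) = x := by
    intro x hx1 hx2
    change pad (m + 1) (pad m (unpad m (unpad (m + 1) x))) = x
    have h3 : pad (m + 1) (unpad (m + 1) x) = x := by rw [pad_unpad, hx1, zero_smul, sub_zero]
    have h4 : ⟪(pole m : Euc (m + 1)), unpad (m + 1) x⟫_ℝ = 0 := by
      rw [← inner_pad_pad, h3, hx2]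
    rw [pad_unpad, h4, zero_smul, sub_zero, h3]
  have hk : ∀ v, padTwice m (unpad m (unpad (m + 1) (spinRot k (padTwice m v)))) =
      spinRot k (padTwice m v) := by
    intro v
    apply hdec
    · rw [← h1, spinRot_inner]
      exact inner_pole_pad _
    · rw [← h2, spinRot_inner]
      exact (inner_pad_pad _ _).trans (inner_pole_pad _)
  let φ : Euc m →ₗᵢ[ℝ] Euc m :=
    ⟨unpad m ∘ₗ unpad (m + 1) ∘ₗ (spinRot k : Euc (m + 2) →ₗ[ℝ] Euc (m + 2)) ∘ₗ
      (padTwice m).toLinearMap, fun v => by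
        rw [← (padTwice m).norm_map]
        refine (congrArg norm (hk v)).trans ?_
        rw [spinRot_norm, (padTwice m).norm_map]⟩
  obtain ⟨l, -, hl, hφ⟩ := exists_list_foldr_hyperRefl (φ.toLinearIsometryEquiv rfl)
  have hkl : ∀ x, spinRot k x = (l.map (padTwice m)).foldr hyperRefl x := by
    intro x
    obtain ⟨a, b, v, rfl⟩ : ∃ (a b : ℝ) (v : Euc m), x = padTwice m v +
        (a • (pole (m + 1) : Euc (m + 2)) + b • pad (m + 1) (pole m)) := by
      refine ⟨⟪(pole (m + 1) : Euc (m + 2)), x⟫_ℝ,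
        ⟪(pole m : Euc (m + 1)), unpad (m + 1) x⟫_ℝ, unpad m (unpad (m + 1) x), ?_⟩
      change _ = pad (m + 1) (pad m (unpad m (unpad (m + 1) x))) + _
      rw [pad_unpad (m := m), map_sub, map_smul, pad_unpad]
      abel
    rw [foldr_hyperRefl_map]
    · rw [← hφ, map_add, map_add, map_smul, map_smul, h1, h2, ← hk v]
      rfl
    · intro v
      rw [inner_add_right, inner_smul_right, inner_smul_right]
      change _ * ⟪pad (m + 1) (pad m v), (pole (m + 1) : Euc (m + 2))⟫_ℝ +
        _ * ⟪pad (m + 1) (pad m v), pad (m + 1) (pole m)⟫_ℝ = 0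
      rw [inner_pad_pad, inner_pad_pole, inner_pad_pole]
      simp
  have hl' : ∀ v ∈ l.map (padTwice m), ‖v‖ = 1 := by
    intro v hv
    obtain ⟨w, hw, rfl⟩ := List.mem_map.1 hv
    rw [(padTwice m).norm_map, hl w hw]
  obtain ⟨he, hor⟩ := Spin.eq_or_eq_neg_vecProd k hl' hkl
  rw [List.length_map] at he
  have hmap : vecProd (l.map (padTwice m)) = CliffordAlgebra.map (padIsometry m) (vecProd l) :=
    vecProd_map (padIsometry m) l
  rcases hor with h | h
  · exact ⟨⟨vecProd l, vecProd_mem_spinGroup l hl he⟩, Subtype.ext (h.trans hmap)⟩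
  -- The sign is absorbed by prefixing the pair e, e, whose product is -1.
  · obtain ⟨e, he1⟩ := exists_unit_vec m
    have hneg : vecProd (e :: e :: l) = -vecProd l := by
      rw [vecProd_cons, vecProd_cons, ← mul_assoc, ι_unit_sq he1, neg_one_mul]
    have hmem : vecProd (e :: e :: l) ∈ spinGroup (stdForm m) := by
      refine vecProd_mem_spinGroup _ ?_ (by simpa [Nat.even_add_one] using he)
      simpa [he1] using hl
    refine ⟨⟨_, hmem⟩, Subtype.ext ?_⟩
    rw [coe_spinIncl]
    change (k : Cl (m + 2)) = CliffordAlgebra.map (padIsometry m) (vecProd (e :: e :: l))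
    rw [hneg, map_neg, ← hmap]
    exact h

theorem frameProj_eq_frameProj_iff {m : ℕ} [NeZero m] (g g' : Spin (m + 2)) :
    frameProj m g = frameProj m g' ↔ ∃ h : Spin m, g' = g * spinIncl m h := by
  constructor
  · intro h
    obtain ⟨h1, h2⟩ := frameProj_eq_iff.1 h.symm
    rw [frameProj_fst] at h1
    rw [frameProj_snd] at h2
    obtain ⟨k, hk⟩ := exists_spinIncl_eq (k := g⁻¹ * g')
      (by rw [spinRot_mul_apply, h1, spinRot_inv_apply_self])
      (by rw [spinRot_mul_apply, h2, spinRot_inv_apply_self])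
    exact ⟨k, by rw [← hk, mul_inv_cancel_left]⟩
  · rintro ⟨h, rfl⟩
    symm
    rw [frameProj_eq_iff, frameProj_fst, frameProj_snd, spinRot_mul_apply, spinRot_mul_apply,
      spinRot_spinIncl_of_inner h fun v => inner_pad_pole _,
      spinRot_spinIncl_of_inner h fun v => by rw [inner_pad_pad, inner_pad_pole]]
    exact ⟨rfl, rfl⟩

/-! ### Principal bundles from local sections -/

/-- The trivialization of `π`, whose fibres are the cosets of `H`, given by a local section. -/
def trivializationOfSection {G H B : Type} [Group G] [TopologicalSpace G] [IsTopologicalGroup G]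
    [Group H] [TopologicalSpace H] [TopologicalSpace B] {i : H →* G} (hi : IsEmbedding i)
    {π : G → B} (hfib : ∀ g g' : G, π g = π g' ↔ ∃ h : H, g' = g * i h) {V : Set B}
    (hV : IsOpen V) (hpre : IsOpen (π ⁻¹' V)) (hπ : ContinuousOn π (π ⁻¹' V)) {s : B → G}
    (hs : ContinuousOn s V) (hsec : ∀ b ∈ V, π (s b) = b) : Bundle.Trivialization H π :=
  -- `Function.invFun i` is meaningful only on the range of i; over V the coset description of the
  -- fibres puts the argument there.
  have key : ∀ g ∈ π ⁻¹' V, i (Function.invFun i ((s (π g))⁻¹ * g)) = (s (π g))⁻¹ * g := by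
    intro g hg
    obtain ⟨h, hh⟩ := (hfib (s (π g)) g).1 (hsec _ hg)
    refine Function.invFun_eq ⟨h, ?_⟩
    rw [eq_inv_mul_iff_mul_eq]
    exact hh.symm
  have hright : ∀ (b : B) (h : H), π (s b * i h) = π (s b) := fun b h =>
    ((hfib _ _).2 ⟨h, rfl⟩).symm
  { toFun := fun g => (π g, Function.invFun i ((s (π g))⁻¹ * g))
    invFun := fun q => s q.1 * i q.2
    source := π ⁻¹' V
    target := V ×ˢ univ
    map_source' := fun g hg => ⟨hg, trivial⟩
    map_target' := fun q hq => by
      change π (s q.1 * i q.2) ∈ V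
      rw [hright, hsec _ hq.1]
      exact hq.1
    left_inv' := fun g hg => by
      change s (π g) * i (Function.invFun i ((s (π g))⁻¹ * g)) = g
      rw [key g hg, mul_inv_cancel_left]
    right_inv' := fun q hq => by
      rw [hright, hsec _ hq.1, inv_mul_cancel_left, Function.leftInverse_invFun hi.injective]
    open_source := hpre
    open_target := hV.prod isOpen_univ
    continuousOn_toFun := by
      refine hπ.prodMk ?_
      -- Continuity of the H-component is tested after the embedding i, where the component becomes
      -- a quotient of continuous maps.
      rw [hi.toIsInducing.continuousOn_iff]
      refine ContinuousOn.congr (f := fun g => (s (π g))⁻¹ * g) ?_ fun g hg => key g hg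
      exact (hs.comp hπ fun g hg => hg).inv.mul continuousOn_id
    continuousOn_invFun :=
      (hs.comp continuousOn_fst fun q hq => hq.1).mul
        (hi.continuous.comp_continuousOn continuousOn_snd)
    baseSet := V
    open_baseSet := hV
    source_eq := rfl
    target_eq := rfl
    proj_toFun := fun _ _ => rfl }

theorem isPrincipalBundleOver_of_sections {G H B : Type} [Group G] [TopologicalSpace G]
    [IsTopologicalGroup G] [Group H] [TopologicalSpace H] [TopologicalSpace B] {i : H →* G}
    (hi : IsClosedEmbedding i) {π : G → B} (hsurj : Function.Surjective π)
    (hfib : ∀ g g' : G, π g = π g' ↔ ∃ h : H, g' = g * i h) {U : Set B} (hU : IsOpen U)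
    (hpre : IsOpen (π ⁻¹' U)) (hπ : ContinuousOn π (π ⁻¹' U))
    (hsec : ∀ b ∈ U, ∃ V : Set B, IsOpen V ∧ b ∈ V ∧ V ⊆ U ∧ ∃ s : B → G, ContinuousOn s V ∧
      ∀ b' ∈ V, π (s b') = b') : IsPrincipalBundleOver i π U where
  isClosedEmbedding := hi
  surjective := hsurj
  fiber_eq := hfib
  isOpen := hU
  continuousOn := hπ
  locallyTrivial b hb := by
    obtain ⟨V, hV, hbV, hVU, s, hs, hsec⟩ := hsec b hb
    have hpreV : IsOpen (π ⁻¹' V) := by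
      have h := hπ.isOpen_inter_preimage hpre hV
      rwa [inter_eq_right.2 (preimage_mono hVU)] at h
    refine ⟨trivializationOfSection hi.isEmbedding hfib hV hpreV
      (hπ.mono (preimage_mono hVU)) hs hsec, hbV, hVU, fun g hg h => ?_⟩
    have hgV : π g ∈ V := hg
    have h1 : π (g * i h) = π g := ((hfib _ _).2 ⟨h, rfl⟩).symm
    obtain ⟨k, hk⟩ := (hfib (s (π g)) g).1 (hsec _ hgV)
    change (π (g * i h), Function.invFun i ((s (π (g * i h)))⁻¹ * (g * i h))) =
      (π g, Function.invFun i ((s (π g))⁻¹ * g) * h)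
    have h2 : (s (π g))⁻¹ * g = i k := by rw [inv_mul_eq_iff_eq_mul]; exact hk
    rw [h1, ← mul_assoc, h2, ← map_mul, Function.leftInverse_invFun hi.injective,
      Function.leftInverse_invFun hi.injective]

/-! ### The bundle over the Stiefel manifold -/

/-- Near a frame (x₀, y₀) covered by g₀, the section to (x, y) turns x₀ to x after turning y₀ to the
vector y pulled back by that first turn. The pulled-back vector is orthogonal to x₀, so the inner
turn leaves x₀ alone. -/
theorem isPrincipalBundleOver_frameProj (m : ℕ) [NeZero m] :
    IsPrincipalBundleOver (spinIncl m) (frameProj m) univ := by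
  refine isPrincipalBundleOver_of_sections (isClosedEmbedding_spinIncl m)
    (frameProj_surjective (NeZero.one_le)) frameProj_eq_frameProj_iff isOpen_univ isOpen_univ
    (continuous_frameProj m).continuousOn fun b _ => ?_
  obtain ⟨g₀, hg₀⟩ := frameProj_surjective (NeZero.one_le) b
  obtain ⟨⟨⟨x₀, y₀⟩, h₀⟩, rfl⟩ : ∃ b', b' = b := ⟨_, rfl⟩
  obtain ⟨hx₀, hy₀⟩ := frameProj_eq_iff.1 hg₀
  let t : Stiefel (m + 2) → Spin (m + 2) := fun q => turn x₀ q.1.1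
  let y : Stiefel (m + 2) → USphere (m + 2) := fun q => spinAct (t q)⁻¹ q.1.2
  let W : Set (Stiefel (m + 2)) := {q | (x₀ : Euc (m + 2)) + q.1.1 ≠ 0}
  have hfst : Continuous fun q : Stiefel (m + 2) => q.1.1 :=
    continuous_fst.comp continuous_subtype_val
  have hsnd : Continuous fun q : Stiefel (m + 2) => q.1.2 :=
    continuous_snd.comp continuous_subtype_val
  have hW : IsOpen W := isOpen_ne_fun
    (continuous_const.add (continuous_subtype_val.comp hfst)) continuous_const
  have ht : ContinuousOn t W :=
    ContinuousOn.turn continuousOn_const hfst.continuousOn fun q hq => hq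
  have hy : ContinuousOn y W :=
    ContinuousOn.spinAct ht.inv hsnd.continuousOn
  have hV : IsOpen (W ∩ y ⁻¹' {z | (y₀ : Euc (m + 2)) + z ≠ 0}) :=
    hy.isOpen_inter_preimage hW (isOpen_ne_fun
      (continuous_const.add continuous_subtype_val) continuous_const)
  have hb : ∀ v : USphere (m + 2), (v : Euc (m + 2)) + v ≠ 0 := by
    intro v h
    rw [← two_smul ℝ] at h
    have h1 : (v : Euc (m + 2)) = 0 := (smul_eq_zero.1 h).resolve_left two_ne_zero
    have h2 := v.norm_coe
    rw [h1, norm_zero] at h2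
    exact zero_ne_one h2
  refine ⟨_, hV, ⟨hb x₀, ?_⟩, subset_univ _, fun q => t q * turn y₀ (y q) * g₀, ?_, ?_⟩
  · have h1 : y ⟨(x₀, y₀), h₀⟩ = y₀ := by
      apply Subtype.ext
      change spinRot (turn x₀ x₀)⁻¹ (y₀ : Euc (m + 2)) = y₀
      conv_lhs => rw [← spinRot_turn_of_inner_of_inner (hb x₀) h₀ h₀]
      exact spinRot_inv_apply_self _ _
    change (y₀ : Euc (m + 2)) + y ⟨(x₀, y₀), h₀⟩ ≠ 0
    rw [h1]
    exact hb y₀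
  · refine ((ht.mono inter_subset_left).mul ?_).mul continuousOn_const
    exact ContinuousOn.turn continuousOn_const (hy.mono inter_subset_left) fun q hq => hq.2
  · rintro q ⟨hq1, hq2⟩
    have h3 : ⟪(x₀ : Euc (m + 2)), (y q : Euc (m + 2))⟫_ℝ = 0 := by
      rw [← spinRot_inner (t q), coe_spinAct, spinRot_apply_inv_self, spinRot_turn_self hq1]
      exact q.2
    rw [frameProj_eq_iff, spinRot_mul_apply, spinRot_mul_apply, spinRot_mul_apply,
      spinRot_mul_apply, hx₀, hy₀]
    constructor
    · rw [spinRot_turn_of_inner_of_inner hq2 (by rw [real_inner_comm]; exact h₀)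
        (by rw [real_inner_comm]; exact h3)]
      exact spinRot_turn_self hq1
    · rw [spinRot_turn_self hq2, coe_spinAct, spinRot_apply_inv_self]

/-! ### The bundle over the product of spheres -/

theorem baseProj_fst {m : ℕ} (g : Spin (m + 2)) :
    ((baseProj m g).1 : Euc (m + 2)) = spinRot g (pole (m + 1)) := rfl

theorem baseProj_snd {m : ℕ} (g : Spin (m + 2)) :
    ((baseProj m g).2 : Euc (m + 1)) =
      rotateBack m (spinRot g (pole (m + 1))) (spinRot g (pad (m + 1) (pole m))) := rfl

theorem baseProj_eq_iff {m : ℕ} {g : Spin (m + 2)} {b : USphere (m + 2) × USphere (m + 1)} :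
    baseProj m g = b ↔ spinRot g (pole (m + 1)) = b.1 ∧
      rotateBack m b.1 (spinRot g (pad (m + 1) (pole m))) = b.2 := by
  rw [Prod.ext_iff, Subtype.ext_iff, Subtype.ext_iff, baseProj_fst, baseProj_snd]
  constructor
  · rintro ⟨h1, h2⟩
    exact ⟨h1, by rw [← h1, h2]⟩
  · rintro ⟨h1, h2⟩
    exact ⟨h1, by rw [h1, h2]⟩

theorem mem_regularBase_iff {m : ℕ} {b : USphere (m + 2) × USphere (m + 1)} :
    b ∈ regularBase m ↔ (pole (m + 1) : Euc (m + 2)) + b.1 ≠ 0 := by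
  rw [regularBase, mem_ofPred_eq, Ne, not_iff_not, Subtype.ext_iff, add_eq_zero_iff_neg_eq]
  exact eq_comm

/-- Over x ≠ -p the second component is an involutive reflection of y; over x = -p it is y itself.
-/
theorem frameToProduct_injective (m : ℕ) : Function.Injective (frameToProduct m) := by
  rintro ⟨⟨x, y⟩, h⟩ ⟨⟨x', y'⟩, h'⟩ heq
  have hx : x = x' := (Prod.ext_iff.1 heq).1
  subst hx
  have hz : rotateBack m x y = rotateBack m x y' :=
    congrArg Subtype.val (Prod.ext_iff.1 heq).2
  have h1 := congrArg (pad (m + 1)) hz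
  suffices hy : y = y' by subst hy; rfl
  apply Subtype.ext
  by_cases h0 : (pole (m + 1) : Euc (m + 2)) + x = 0
  · rw [pad_rotateBack h, pad_rotateBack h', add_comm (x : Euc (m + 2)), h0, smul_zero,
      smul_zero, sub_zero, sub_zero] at h1
    exact h1
  · rw [pad_rotateBack_eq_hyperRefl h h0, pad_rotateBack_eq_hyperRefl h' h0] at h1
    rw [← hyperRefl_hyperRefl (midDir (pole (m + 1)) x) (y : Euc (m + 2)), h1,
      hyperRefl_hyperRefl]

theorem rotateBack_turn {m : ℕ} {x : USphere (m + 2)}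
    (h0 : (pole (m + 1) : Euc (m + 2)) + x ≠ 0) (z : USphere (m + 1)) :
    rotateBack m x (spinRot (turn (pole (m + 1)) x) (pad (m + 1) z)) = z := by
  apply pad_injective
  have h1 : ⟪(x : Euc (m + 2)), (spinAct (turn (pole (m + 1)) x) (padSphere z) : Euc (m + 2))⟫_ℝ
      = 0 := by
    rw [coe_spinAct]
    conv_lhs => rw [← spinRot_turn_self h0]
    rw [spinRot_inner]
    exact inner_pole_pad _
  refine (pad_rotateBack_eq_hyperRefl h1 h0).trans ?_
  rw [coe_spinAct, coe_padSphere, spinRot_turn_of_inner _ _ (inner_pole_pad _),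
    hyperRefl_hyperRefl]

theorem frameToProduct_surjective (m : ℕ) : Function.Surjective (frameToProduct m) := by
  rintro ⟨x, z⟩
  by_cases h0 : (pole (m + 1) : Euc (m + 2)) + x = 0
  · have hx : (x : Euc (m + 2)) = -(pole (m + 1) : Euc (m + 2)) :=
      (neg_eq_of_add_eq_zero_right h0).symm
    have hxz : ⟪(x : Euc (m + 2)), (padSphere z : Euc (m + 2))⟫_ℝ = 0 := by
      rw [hx, inner_neg_left, neg_eq_zero]
      exact inner_pole_pad _
    refine ⟨⟨(x, padSphere z), hxz⟩, Prod.ext rfl (Subtype.ext (pad_injective _ ?_))⟩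
    refine (pad_rotateBack hxz).trans ?_
    rw [add_comm (x : Euc (m + 2)), h0, smul_zero, sub_zero]
    rfl
  · refine ⟨⟨(x, spinAct (turn (pole (m + 1)) x) (padSphere z)), ?_⟩,
      Prod.ext rfl (Subtype.ext (rotateBack_turn h0 z))⟩
    change ⟪(x : Euc (m + 2)), spinRot (turn (pole (m + 1)) x) (padSphere z : Euc (m + 2))⟫_ℝ = 0
    conv_lhs => rw [← spinRot_turn_self h0]
    rw [spinRot_inner]
    exact inner_pole_pad _

theorem baseProj_surjective {m : ℕ} (hm : 1 ≤ m) : Function.Surjective (baseProj m) :=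
  (frameToProduct_surjective m).comp (frameProj_surjective hm)

theorem isOpen_regularBase (m : ℕ) : IsOpen (regularBase m) :=
  isOpen_ne_fun continuous_fst continuous_const

/-- Continuity of `baseProj` is established only over the regular base. Openness of the preimage
comes from the first component alone, which is continuous everywhere. -/
theorem isOpen_preimage_regularBase (m : ℕ) : IsOpen (baseProj m ⁻¹' regularBase m) :=
  isOpen_ne_fun ((continuous_fst.comp continuous_subtype_val).comp (continuous_frameProj m))
    continuous_const

theorem continuousOn_rotateBack {X : Type*} [TopologicalSpace X] {m : ℕ} {x y : X → Euc (m + 2)}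
    {s : Set X} (hx : ContinuousOn x s) (hy : ContinuousOn y s)
    (h : ∀ a ∈ s, 1 + ⟪(pole (m + 1) : Euc (m + 2)), x a⟫_ℝ ≠ 0) :
    ContinuousOn (fun a => rotateBack m (x a) (y a)) s := by
  have hu : Continuous (unpad (m + 1)) := LinearMap.continuous_of_finiteDimensional _
  have h1 : ContinuousOn (fun a => ⟪(pole (m + 1) : Euc (m + 2)), y a⟫_ℝ /
      (1 + ⟪(pole (m + 1) : Euc (m + 2)), x a⟫_ℝ)) s :=
    (ContinuousOn.inner continuousOn_const hy).div
      (continuousOn_const.add (ContinuousOn.inner continuousOn_const hx)) h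
  have h2 : ContinuousOn (fun a => x a + (pole (m + 1) : Euc (m + 2))) s :=
    hx.add continuousOn_const
  exact hu.comp_continuousOn (hy.sub (h1.smul h2))

theorem continuousOn_baseProj (m : ℕ) :
    ContinuousOn (baseProj m) (baseProj m ⁻¹' regularBase m) := by
  have h : ∀ v : Euc (m + 2), Continuous fun g : Spin (m + 2) => spinRot g v := fun v =>
    Continuous.spinRot_apply continuous_id continuous_const
  refine ContinuousOn.prodMk (f := fun g => (baseProj m g).1) (g := fun g => (baseProj m g).2)
    ((continuous_fst.comp continuous_subtype_val).comp
      (continuous_frameProj m)).continuousOn ?_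
  rw [IsInducing.subtypeVal.continuousOn_iff]
  exact continuousOn_rotateBack (h _).continuousOn (h _).continuousOn fun g hg =>
    one_add_inner_ne_zero (mem_regularBase_iff.1 hg)

/-- Here g₀ takes the standard frame to (p, z₀), and the section turns z₀ to z inside p^⊥ and then p
to x. It needs localisation in z only; in x it is defined wherever x ≠ -p. -/
theorem isPrincipalBundleOver_baseProj (m : ℕ) [NeZero m] :
    IsPrincipalBundleOver (spinIncl m) (baseProj m) (regularBase m) := by
  refine isPrincipalBundleOver_of_sections (isClosedEmbedding_spinIncl m)
    (baseProj_surjective NeZero.one_le)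
    (fun g g' => (frameToProduct_injective m).eq_iff.trans (frameProj_eq_frameProj_iff g g'))
    (isOpen_regularBase m) (isOpen_preimage_regularBase m) (continuousOn_baseProj m) ?_
  rintro ⟨x₀, z₀⟩ hb
  obtain ⟨g₀, hg₀⟩ := frameProj_surjective (NeZero.one_le (n := m))
    ⟨(pole (m + 1), padSphere z₀), inner_pole_pad _⟩
  obtain ⟨hp, hz⟩ := frameProj_eq_iff.1 hg₀
  have hV : IsOpen {z : USphere (m + 1) | (z₀ : Euc (m + 1)) + z ≠ 0} := isOpen_ne_fun
    (continuous_const.add continuous_subtype_val) continuous_const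
  refine ⟨regularBase m ∩ Prod.snd ⁻¹' {z | (z₀ : Euc (m + 1)) + z ≠ 0},
    (isOpen_regularBase m).inter (hV.preimage continuous_snd), ⟨hb, ?_⟩, inter_subset_left,
    fun b => turn (pole (m + 1)) b.1 * turn (padSphere z₀) (padSphere b.2) * g₀, ?_, ?_⟩
  · change (z₀ : Euc (m + 1)) + z₀ ≠ 0
    intro h
    have h2 := z₀.norm_coe
    rw [← two_smul ℝ] at h
    rw [(smul_eq_zero.1 h).resolve_left two_ne_zero, norm_zero] at h2
    exact zero_ne_one h2
  · refine ContinuousOn.mul (ContinuousOn.mul ?_ ?_) continuousOn_const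
    · exact ContinuousOn.turn continuousOn_const continuousOn_fst
        fun b hb => mem_regularBase_iff.1 hb.1
    · refine ContinuousOn.turn continuousOn_const
        ((continuous_padSphere _).comp_continuousOn continuousOn_snd) fun b hb => ?_
      change pad (m + 1) z₀ + pad (m + 1) b.2 ≠ 0
      rw [← map_add, ← map_zero (pad (m + 1)), (pad_injective _).ne_iff]
      exact hb.2
  · rintro ⟨x, z⟩ ⟨hx, hz'⟩
    have hx' := mem_regularBase_iff.1 hx
    have hz'' : (padSphere z₀ : Euc (m + 2)) + padSphere z ≠ 0 := by
      change pad (m + 1) z₀ + pad (m + 1) z ≠ 0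
      rw [← map_add, ← map_zero (pad (m + 1)), (pad_injective _).ne_iff]
      exact hz'
    rw [baseProj_eq_iff, spinRot_mul_apply, spinRot_mul_apply, spinRot_mul_apply,
      spinRot_mul_apply, hp, hz]
    constructor
    · rw [spinRot_turn_of_inner_of_inner hz'' (inner_pad_pole _) (inner_pad_pole _)]
      exact spinRot_turn_self hx'
    · rw [spinRot_turn_self hz'']
      exact rotateBack_turn hx' z

/-! ### The invariant measure -/

section InvariantMeasure

variable {G : Type} [Group G] [TopologicalSpace G] [IsTopologicalGroup G] [CompactSpace G]
  [MeasurableSpace G] [BorelSpace G]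

theorem isHaarMeasure_of_isProbabilityMeasure (ν : Measure G) [IsProbabilityMeasure ν]
    [ν.IsMulLeftInvariant] : ν.IsHaarMeasure :=
  Measure.isHaarMeasure_of_isCompact_nonempty_interior ν univ isCompact_univ (by simp) (by simp)
    (by simp)

theorem isProbabilityMeasure_haarMeasure_top :
    IsProbabilityMeasure (Measure.haarMeasure (⊤ : TopologicalSpace.PositiveCompacts G)) :=
  ⟨by simpa using Measure.haarMeasure_self (K₀ := (⊤ : TopologicalSpace.PositiveCompacts G))⟩

/-- Right invariance is the unimodularity of compact groups: a right translate of the measure is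
again a left-invariant probability measure, and there is only one. -/
theorem isNormalisedInvariant_haarMeasure_top :
    IsNormalisedInvariant (Measure.haarMeasure (⊤ : TopologicalSpace.PositiveCompacts G)) where
  isProbabilityMeasure := isProbabilityMeasure_haarMeasure_top
  isMulLeftInvariant := inferInstance
  isMulRightInvariant := by
    have := isProbabilityMeasure_haarMeasure_top (G := G)
    refine ⟨fun g => ?_⟩
    have h1 : IsProbabilityMeasure ((Measure.haarMeasure
        (⊤ : TopologicalSpace.PositiveCompacts G)).map (· * g)) :=
      Measure.isProbabilityMeasure_map (measurable_mul_const g).aemeasurable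
    have h2 := isHaarMeasure_of_isProbabilityMeasure ((Measure.haarMeasure
        (⊤ : TopologicalSpace.PositiveCompacts G)).map (· * g))
    exact Measure.isHaarMeasure_eq_of_isProbabilityMeasure _ _

theorem IsNormalisedInvariant.eq_haarMeasure_top {ν : Measure G} (hν : IsNormalisedInvariant ν) :
    ν = Measure.haarMeasure (⊤ : TopologicalSpace.PositiveCompacts G) := by
  have := isProbabilityMeasure_haarMeasure_top (G := G)
  have := hν.isProbabilityMeasure
  have := hν.isMulLeftInvariant
  have := isHaarMeasure_of_isProbabilityMeasure ν
  exact Measure.isHaarMeasure_eq_of_isProbabilityMeasure _ _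

end InvariantMeasure

theorem exists_spinRot_pole {m : ℕ} (x : USphere (m + 2)) :
    ∃ g : Spin (m + 2), spinRot g (pole (m + 1)) = x := by
  obtain ⟨g, hg, -⟩ := exists_spinRot_eq (v := pole (m + 1)) (w := x)
    (f := padSphere (pole m)) (inner_pole_pad _)
  exact ⟨g, hg⟩

theorem continuous_spinRot_const {N : ℕ} (v : Euc N) :
    Continuous fun g : Spin N => spinRot g v :=
  Continuous.spinRot_apply continuous_id continuous_const

theorem measurable_inner_spinRot {N : ℕ} (a b : Euc N) :
    Measurable fun g : Spin N => ENNReal.ofReal (⟪a, spinRot g b⟫_ℝ ^ 2) := by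
  have h : Continuous fun g : Spin N => ⟪a, spinRot g b⟫_ℝ ^ 2 :=
    (continuous_const.inner (continuous_spinRot_const b)).pow 2
  exact (ENNReal.continuous_ofReal.comp h).measurable

theorem lintegral_inner_spinRot_eq {m : ℕ} (μ : Measure (Spin (m + 2))) [μ.IsMulLeftInvariant]
    (a : USphere (m + 2)) (b : Euc (m + 2)) :
    ∫⁻ g, ENNReal.ofReal (⟪(a : Euc (m + 2)), spinRot g b⟫_ℝ ^ 2) ∂μ =
      ∫⁻ g, ENNReal.ofReal (⟪(pole (m + 1) : Euc (m + 2)), spinRot g b⟫_ℝ ^ 2) ∂μ := by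
  obtain ⟨k, hk⟩ := exists_spinRot_pole a
  rw [← lintegral_mul_left_eq_self (fun g : Spin (m + 2) =>
    ENNReal.ofReal (⟪(a : Euc (m + 2)), spinRot g b⟫_ℝ ^ 2)) k]
  simp only [← hk, spinRot_mul_apply, spinRot_inner]

/-- The group is transitive on the sphere, so by left invariance the mean does not depend on a.
Summing over the canonical basis gives the mean of ‖b‖² = 1. -/
theorem lintegral_inner_spinRot {m : ℕ} (μ : Measure (Spin (m + 2))) [μ.IsMulLeftInvariant]
    [IsProbabilityMeasure μ] (a b : USphere (m + 2)) :
    ((m + 2 : ℕ) : ℝ≥0∞) *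
      ∫⁻ g, ENNReal.ofReal (⟪(a : Euc (m + 2)), spinRot g b⟫_ℝ ^ 2) ∂μ = 1 := by
  have h1 : ∀ i : Fin (m + 2), ∫⁻ g : Spin (m + 2), ENNReal.ofReal (spinRot g b i ^ 2) ∂μ =
      ∫⁻ g, ENNReal.ofReal (⟪(pole (m + 1) : Euc (m + 2)), spinRot g b⟫_ℝ ^ 2) ∂μ := by
    intro i
    rw [← lintegral_inner_spinRot_eq μ ⟨EuclideanSpace.single i 1, by simp⟩]
    simp [EuclideanSpace.inner_single_left]
  have h2 : ∀ g : Spin (m + 2), ∑ i, ENNReal.ofReal (spinRot g (b : Euc (m + 2)) i ^ 2) = 1 := by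
    intro g
    rw [← ENNReal.ofReal_sum_of_nonneg fun i _ => sq_nonneg _, ← EuclideanSpace.real_norm_sq_eq,
      spinRot_norm, b.norm_coe]
    simp
  rw [lintegral_inner_spinRot_eq]
  calc _ = ∑ i : Fin (m + 2),
        ∫⁻ g : Spin (m + 2), ENNReal.ofReal (spinRot g (b : Euc (m + 2)) i ^ 2) ∂μ := by
        rw [Finset.sum_congr rfl fun i _ => h1 i]
        simp
    _ = ∫⁻ _ : Spin (m + 2), 1 ∂μ := by
        rw [← lintegral_finsetSum]
        · simp only [h2]
        · intro i _
          have h := measurable_inner_spinRot (EuclideanSpace.single i (1 : ℝ)) (b : Euc (m + 2))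
          simpa [EuclideanSpace.inner_single_left] using h
    _ = 1 := by simp

theorem measure_inner_spinRot_ge_le {m : ℕ} (μ : Measure (Spin (m + 2))) [μ.IsMulLeftInvariant]
    [IsProbabilityMeasure μ] (a b : USphere (m + 2)) {δ : ℝ} (hδ : 0 < δ) :
    μ {g | δ ≤ |⟪(a : Euc (m + 2)), spinRot g b⟫_ℝ|} ≤
      ENNReal.ofReal (((m + 2 : ℕ) * δ ^ 2 : ℝ)⁻¹) := by
  have h1 := mul_meas_ge_le_lintegral (μ := μ)
    (measurable_inner_spinRot (a : Euc (m + 2)) b) (ENNReal.ofReal (δ ^ 2))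
  have h2 : {g : Spin (m + 2) | δ ≤ |⟪(a : Euc (m + 2)), spinRot g b⟫_ℝ|} ⊆
      {g | ENNReal.ofReal (δ ^ 2) ≤ ENNReal.ofReal (⟪(a : Euc (m + 2)), spinRot g b⟫_ℝ ^ 2)} := by
    intro g hg
    refine ENNReal.ofReal_le_ofReal ?_
    rw [← sq_abs ⟪(a : Euc (m + 2)), spinRot g b⟫_ℝ]
    exact pow_le_pow_left₀ hδ.le hg 2
  have h3 : ((m + 2 : ℕ) : ℝ≥0∞) * ENNReal.ofReal (δ ^ 2) *
      μ {g | δ ≤ |⟪(a : Euc (m + 2)), spinRot g b⟫_ℝ|} ≤ 1 := by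
    rw [← lintegral_inner_spinRot μ a b, mul_assoc]
    gcongr
    exact (mul_le_mul_right (measure_mono h2) _).trans h1
  have h4 : ((m + 2 : ℕ) : ℝ≥0∞) * ENNReal.ofReal (δ ^ 2) =
      ENNReal.ofReal ((m + 2 : ℕ) * δ ^ 2 : ℝ) := by
    rw [ENNReal.ofReal_mul (by positivity), ENNReal.ofReal_natCast]
  rw [ENNReal.ofReal_inv_of_pos (by positivity), ENNReal.le_inv_iff_mul_le, mul_comm, ← h4]
  exact h3

theorem measure_preimage_compl_regularBase {m : ℕ} (μ : Measure (Spin (m + 2)))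
    [μ.IsMulLeftInvariant] [IsProbabilityMeasure μ] :
    μ (baseProj m ⁻¹' (regularBase m)ᶜ) = 0 := by
  have hS : ∀ x : USphere (m + 2), MeasurableSet {g : Spin (m + 2) | (baseProj m g).1 = x} :=
    fun x => (isClosed_eq ((continuous_fst.comp continuous_subtype_val).comp
      (continuous_frameProj m)) continuous_const).measurableSet
  have hset : baseProj m ⁻¹' (regularBase m)ᶜ =
      {g : Spin (m + 2) | (baseProj m g).1 = -pole (m + 1)} := by
    ext g
    simp [regularBase]
  have hall : ∀ x : USphere (m + 2), μ {g : Spin (m + 2) | (baseProj m g).1 = x} =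
      μ {g : Spin (m + 2) | (baseProj m g).1 = pole (m + 1)} := by
    intro x
    obtain ⟨k, hk⟩ := exists_spinRot_pole x
    rw [← measure_preimage_mul μ k]
    congr 1
    ext g
    simp only [mem_preimage, mem_ofPred_eq, Subtype.ext_iff, baseProj_fst, spinRot_mul_apply, ← hk]
    exact (LinearIsometry.injective
      (⟨(spinRot k : Euc (m + 2) →ₗ[ℝ] Euc (m + 2)), spinRot_norm k⟩ :
        Euc (m + 2) →ₗᵢ[ℝ] Euc (m + 2))).eq_iff
  rw [hset, hall]
  by_contra hne
  have : ConnectedSpace (USphere (m + 2)) := USphere.connectedSpace (by omega)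
  have : Nontrivial (USphere (m + 2)) := ⟨pole (m + 1), -pole (m + 1), fun h => by
    have h1 := congrArg (fun v : USphere (m + 2) =>
      ⟪(v : Euc (m + 2)), (pole (m + 1) : Euc (m + 2))⟫_ℝ) h
    simp only [Metric.sphere, coe_neg_sphere, inner_neg_left, (pole (m + 1)).inner_self] at h1
    norm_num at h1⟩
  have : Infinite (USphere (m + 2)) := PreconnectedSpace.infinite
  obtain ⟨f⟩ : Nonempty (ℕ ↪ USphere (m + 2)) := ⟨Infinite.natEmbedding _⟩
  -- Countably many disjoint fibres of equal positive measure would have infinite total measure.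
  have h1 := measure_iUnion (μ := μ)
    (f := fun n : ℕ => {g : Spin (m + 2) | (baseProj m g).1 = f n}) (by
      intro i j hij
      refine Set.disjoint_left.2 fun g hi hj => hij (f.injective ?_)
      exact Eq.trans (Eq.symm hi) hj) fun n => hS _
  simp only [hall, ENNReal.tsum_const_eq_top_of_ne_zero hne] at h1
  exact measure_ne_top μ _ h1

/-! ### The preimage of a bi-equator is a submanifold -/

/-- The infinitesimal rotation that takes the unit vector `a` to the orthogonal vector `b`. -/
def wedgeOp {N : ℕ} (a b : Euc N) : Euc N →L[ℝ] Euc N :=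
  (innerSL ℝ a).smulRight b - (innerSL ℝ b).smulRight a

theorem wedgeOp_apply {N : ℕ} (a b z : Euc N) :
    wedgeOp a b z = ⟪a, z⟫_ℝ • b - ⟪b, z⟫_ℝ • a := by
  simp [wedgeOp]

theorem wedgeOp_skew {N : ℕ} (a b z w : Euc N) :
    ⟪wedgeOp a b z, w⟫_ℝ = -⟪z, wedgeOp a b w⟫_ℝ := by
  rw [wedgeOp_apply, wedgeOp_apply, inner_sub_left, inner_sub_right, real_inner_smul_left,
    real_inner_smul_left, real_inner_smul_right, real_inner_smul_right, real_inner_comm z a,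
    real_inner_comm z b]
  ring

theorem inner_unpad {m : ℕ} (v : Euc m) (w : Euc (m + 1)) :
    ⟪v, unpad m w⟫_ℝ = ⟪pad m v, w⟫_ℝ := by
  rw [← inner_pad_pad, pad_unpad, inner_sub_right, inner_smul_right, inner_pad_pole, mul_zero,
    sub_zero]

theorem inner_rotateBack {m : ℕ} (v : Euc (m + 1)) (x y : Euc (m + 2)) :
    ⟪v, rotateBack m x y⟫_ℝ = ⟪pad (m + 1) v, y⟫_ℝ -
      ⟪(pole (m + 1) : Euc (m + 2)), y⟫_ℝ / (1 + ⟪(pole (m + 1) : Euc (m + 2)), x⟫_ℝ) *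
        ⟪pad (m + 1) v, x⟫_ℝ := by
  change ⟪v, unpad (m + 1) _⟫_ℝ = _
  rw [inner_unpad, inner_sub_right, inner_smul_right, inner_add_right, inner_pad_pole, add_zero]

/-- The rotation is moved to the other side of the inner product. For fixed x the second equation of
the bi-equator becomes the orthogonality of y to one unit vector w of x^⊥. -/
theorem inner_rotateBack_eq {m : ℕ} (v : Euc (m + 1)) {x : USphere (m + 2)} {y : Euc (m + 2)}
    (h0 : (pole (m + 1) : Euc (m + 2)) + x ≠ 0) (hxy : ⟪(x : Euc (m + 2)), y⟫_ℝ = 0) :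
    ⟪v, rotateBack m x y⟫_ℝ = ⟪spinRot (turn (pole (m + 1)) x) (pad (m + 1) v), y⟫_ℝ := by
  rw [inner_rotateBack, spinRot_turn_of_inner _ _ (inner_pole_pad _), hyperRefl_midDir h0,
    inner_sub_left, real_inner_smul_left, inner_add_left, inner_add_left, hxy, inner_pole_pad,
    add_zero, zero_add, real_inner_comm (pad (m + 1) v) (x : Euc (m + 2))]
  ring

theorem inner_spinRot_turn_pad {m : ℕ} {x : USphere (m + 2)}
    (h0 : (pole (m + 1) : Euc (m + 2)) + x ≠ 0) (v : Euc (m + 1)) :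
    ⟪(x : Euc (m + 2)), spinRot (turn (pole (m + 1)) x) (pad (m + 1) v)⟫_ℝ = 0 := by
  conv_lhs => rw [← spinRot_turn_self h0]
  rw [spinRot_inner, inner_pole_pad]

theorem mem_preimage_biequator_iff {m : ℕ} {u : USphere (m + 2)} {v : USphere (m + 1)}
    {g : Spin (m + 2)} : g ∈ baseProj m ⁻¹' (equator u ×ˢ equator v) ↔
      ⟪(u : Euc (m + 2)), spinRot g (pole (m + 1))⟫_ℝ = 0 ∧
        ⟪(v : Euc (m + 1)),
          rotateBack m (spinRot g (pole (m + 1))) (spinRot g (pad (m + 1) (pole m)))⟫_ℝ = 0 :=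
  Iff.rfl

/-- The defining map of the preimage of a bi-equator. -/
def biequatorMap {m : ℕ} (u : USphere (m + 2)) (v : USphere (m + 1))
    (R : Euc (m + 2) →L[ℝ] Euc (m + 2)) : Euc 2 :=
  WithLp.toLp 2 ![⟪(u : Euc (m + 2)), R (pole (m + 1))⟫_ℝ,
    ⟪(v : Euc (m + 1)), rotateBack m (R (pole (m + 1))) (R (pad (m + 1) (pole m)))⟫_ℝ]

theorem biequatorMap_zero {m : ℕ} (u : USphere (m + 2)) (v : USphere (m + 1))
    (R : Euc (m + 2) →L[ℝ] Euc (m + 2)) :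
    biequatorMap u v R 0 = ⟪(u : Euc (m + 2)), R (pole (m + 1))⟫_ℝ := rfl

theorem biequatorMap_one {m : ℕ} (u : USphere (m + 2)) (v : USphere (m + 1))
    (R : Euc (m + 2) →L[ℝ] Euc (m + 2)) :
    biequatorMap u v R 1 = ⟪(v : Euc (m + 1)),
      rotateBack m (R (pole (m + 1))) (R (pad (m + 1) (pole m)))⟫_ℝ := rfl

theorem contDiffAt_biequatorMap {m : ℕ} (u : USphere (m + 2)) (v : USphere (m + 1))
    {R : Euc (m + 2) →L[ℝ] Euc (m + 2)}
    (hR : 1 + ⟪(pole (m + 1) : Euc (m + 2)), R (pole (m + 1))⟫_ℝ ≠ 0) :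
    ContDiffAt ℝ ∞ (biequatorMap u v) R := by
  have h : ∀ a b : Euc (m + 2), ContDiffAt ℝ ∞
      (fun R : Euc (m + 2) →L[ℝ] Euc (m + 2) => ⟪a, R b⟫_ℝ) R := fun a b =>
    ContDiffAt.inner ℝ contDiffAt_const
      (ContinuousLinearMap.apply ℝ (Euc (m + 2)) b).contDiff.contDiffAt
  rw [contDiffAt_euclidean]
  intro i
  fin_cases i
  · exact h _ _
  · change ContDiffAt ℝ ∞ (fun R : Euc (m + 2) →L[ℝ] Euc (m + 2) => ⟪(v : Euc (m + 1)),
      rotateBack m (R (pole (m + 1))) (R (pad (m + 1) (pole m)))⟫_ℝ) R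
    simp only [inner_rotateBack]
    exact (h _ _).sub (((h _ _).div (contDiffAt_const.add (h _ _)) hR).mul (h _ _))

/-- A component of the differential is determined along a line where it is affine. -/
theorem fderiv_apply_eq_of_line {E : Type*} [NormedAddCommGroup E] [NormedSpace ℝ E] {k : ℕ}
    {F : E → Euc k} {R W : E} (hF : DifferentiableAt ℝ F R) (i : Fin k) {a c : ℝ}
    (h : ∀ t : ℝ, F (R + t • W) i = a + t * c) : fderiv ℝ F R W i = c := by
  have h1 : HasDerivAt (fun t : ℝ => F (R + t • W)) (fderiv ℝ F R W) 0 :=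
    hF.hasFDerivAt.hasLineDerivAt W
  have h2 : HasDerivAt (fun t : ℝ => F (R + t • W) i) (fderiv ℝ F R W i) 0 :=
    (EuclideanSpace.proj (𝕜 := ℝ) i).hasFDerivAt.comp_hasDerivAt (0 : ℝ) h1
  simp only [h] at h2
  have h3 : HasDerivAt (fun t : ℝ => a + t * c) (1 * c) 0 :=
    ((hasDerivAt_id (0 : ℝ)).mul_const c).const_add a
  rw [h2.unique h3, one_mul]

/-- Conjugation by the rotation preserves skewness, so tangent vectors may equally be written with
the infinitesimal rotation on the left, where its effect on x = R p and y = R p' is visible. -/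
theorem exists_skew_comp {N : ℕ} (g : Spin N) (a b : Euc N) :
    ∃ X : Euc N →L[ℝ] Euc N, (∀ z w, ⟪X z, w⟫_ℝ = -⟪z, X w⟫_ℝ) ∧
      (spinRot g).comp X = (wedgeOp a b).comp (spinRot g) := by
  refine ⟨(spinRot g⁻¹).comp ((wedgeOp a b).comp (spinRot g)), fun z w => ?_, ?_⟩
  · simp only [ContinuousLinearMap.comp_apply]
    rw [← spinRot_inner g, spinRot_apply_inv_self, wedgeOp_skew, ← spinRot_inner g z,
      spinRot_apply_inv_self]
  · ext1 z
    simp only [ContinuousLinearMap.comp_apply, spinRot_apply_inv_self]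

theorem mem_regularBase_of_equator {m : ℕ} {u : USphere (m + 2)} {v : USphere (m + 1)}
    (hu : -pole (m + 1) ∉ equator u) {b : USphere (m + 2) × USphere (m + 1)}
    (hb : b ∈ equator u ×ˢ equator v) : b ∈ regularBase m :=
  fun h => hu (h ▸ hb.1)

/-- The infinitesimal rotation of x towards u moves the first equation at rate 1. That of y towards
w, where w ∈ x^⊥ is the vector paired with y in the second equation, fixes x and moves the second
equation at rate 1. The differential is thus triangular on this pair. -/
theorem isSpinSubmanifold_preimage_biequator {m : ℕ} {u : USphere (m + 2)} (v : USphere (m + 1))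
    (hu : -pole (m + 1) ∉ equator u) :
    IsSpinSubmanifold 2 (baseProj m ⁻¹' (equator u ×ˢ equator v)) := by
  intro g hg
  have hreg : ∀ h : Spin (m + 2), baseProj m h ∈ regularBase m →
      1 + ⟪(pole (m + 1) : Euc (m + 2)), spinRot h (pole (m + 1))⟫_ℝ ≠ 0 := by
    intro h hh
    have h1 := one_add_inner_ne_zero (mem_regularBase_iff.1 hh)
    rwa [baseProj_fst] at h1
  have hgreg : baseProj m g ∈ regularBase m :=
    mem_regularBase_of_equator (b := baseProj m g) hu hg
  have h0 := mem_regularBase_iff.1 hgreg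
  have hsmooth : ∀ h ∈ baseProj m ⁻¹' regularBase m,
      ContDiffAt ℝ ∞ (biequatorMap u v) (spinRot h) := fun h hh =>
    contDiffAt_biequatorMap u v (hreg h hh)
  refine ⟨baseProj m ⁻¹' regularBase m, isOpen_preimage_regularBase m, hgreg, biequatorMap u v,
    hsmooth, fun h _ => ?_, ?_⟩
  · rw [mem_preimage_biequator_iff, ← biequatorMap_zero u v, ← biequatorMap_one u v]
    constructor
    · rintro ⟨h1, h2⟩
      ext i
      fin_cases i
      exacts [h1, h2]
    · intro h1
      rw [h1]
      exact ⟨rfl, rfl⟩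
  · have hd : DifferentiableAt ℝ (biequatorMap u v) (spinRot g) :=
      (contDiffAt_biequatorMap u v (hreg g hgreg)).differentiableAt (by simp)
    obtain ⟨x, hx⟩ : ∃ x : USphere (m + 2), x = (baseProj m g).1 := ⟨_, rfl⟩
    have hxg : spinRot g (pole (m + 1)) = x := by rw [hx]; rfl
    rw [← hx] at h0
    obtain ⟨y, hy⟩ : ∃ y : USphere (m + 2), y = (frameProj m g).1.2 := ⟨_, rfl⟩
    have hyg : spinRot g (pad (m + 1) (pole m)) = y := by rw [hy]; rfl
    have hxy : ⟪(x : Euc (m + 2)), (y : Euc (m + 2))⟫_ℝ = 0 := by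
      rw [← hxg, ← hyg, spinRot_inner, inner_pole_pad]
    obtain ⟨hux, hvz⟩ := mem_preimage_biequator_iff.1 hg
    rw [hxg, hyg, inner_rotateBack_eq _ h0 hxy] at hvz
    rw [hxg] at hux
    obtain ⟨w, hw⟩ : ∃ w : Euc (m + 2), w = spinRot (turn (pole (m + 1)) x) (pad (m + 1) v) :=
      ⟨_, rfl⟩
    have hww : ⟪w, w⟫_ℝ = 1 := by rw [hw, spinRot_inner, inner_pad_pad, v.inner_self]
    have hxw : ⟪(x : Euc (m + 2)), w⟫_ℝ = 0 := by rw [hw, inner_spinRot_turn_pad h0]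
    rw [← hw] at hvz
    obtain ⟨X₁, hX₁, hgX₁⟩ := exists_skew_comp g (x : Euc (m + 2)) u
    obtain ⟨X₂, hX₂, hgX₂⟩ := exists_skew_comp g (y : Euc (m + 2)) w
    have hline : ∀ (a b z : Euc (m + 2)) (t : ℝ),
        (spinRot g + t • (wedgeOp a b).comp (spinRot g)) z =
          spinRot g z + t • wedgeOp a b (spinRot g z) := fun a b z t => by simp
    have hL₁ : fderiv ℝ (biequatorMap u v) (spinRot g) ((spinRot g).comp X₁) 0 = 1 := by
      refine fderiv_apply_eq_of_line hd 0 (a := 0) fun t => ?_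
      rw [hgX₁, biequatorMap_zero, hline, hxg, wedgeOp_apply, hux, x.inner_self, zero_smul,
        one_smul, sub_zero, inner_add_right, inner_smul_right, u.inner_self, hux]
    have hzero : ∀ t : ℝ, (spinRot g + t • (spinRot g).comp X₂) (pole (m + 1)) = x := by
      intro t
      rw [hgX₂, hline, hxg, wedgeOp_apply, real_inner_comm, hxy, real_inner_comm, hxw]
      simp
    have hL₂ : fderiv ℝ (biequatorMap u v) (spinRot g) ((spinRot g).comp X₂) 0 = 0 := by
      refine fderiv_apply_eq_of_line hd 0 (a := 0) fun t => ?_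
      rw [biequatorMap_zero, hzero, hux, mul_zero, add_zero]
    -- The straight line leaves the rotations, but along it the image of the pole stays x and the
    -- other image y + t w stays in x^⊥, so the second equation is affine in t.
    have hL₃ : fderiv ℝ (biequatorMap u v) (spinRot g) ((spinRot g).comp X₂) 1 = 1 := by
      refine fderiv_apply_eq_of_line hd 1 (a := 0) fun t => ?_
      have h1 : (spinRot g + t • (spinRot g).comp X₂) (pad (m + 1) (pole m)) =
          (y : Euc (m + 2)) + t • w := by
        rw [hgX₂, hline, hyg, wedgeOp_apply, hvz, y.inner_self, zero_smul, one_smul, sub_zero]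
      rw [biequatorMap_one, hzero, h1, inner_rotateBack_eq _ h0, ← hw, inner_add_right,
        inner_smul_right, hvz, hww]
      rw [inner_add_right, inner_smul_right, hxy, hxw, mul_zero, add_zero]
    intro c
    obtain ⟨L, hL⟩ : ∃ L, L = fderiv ℝ (biequatorMap u v) (spinRot g) := ⟨_, rfl⟩
    rw [← hL] at hL₁ hL₂ hL₃ ⊢
    -- Forward substitution in the triangular system; the off-diagonal entry is never computed.
    refine ⟨c 0 • X₁ + (c 1 - c 0 * L ((spinRot g).comp X₁) 1) • X₂, fun a b => ?_, ?_⟩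
    · simp only [add_apply, smul_apply, inner_add_left,
        inner_add_right, real_inner_smul_left, real_inner_smul_right, hX₁ a b, hX₂ a b]
      ring
    · rw [ContinuousLinearMap.comp_add, ContinuousLinearMap.comp_smul,
        ContinuousLinearMap.comp_smul, map_add, map_smul, map_smul]
      ext i
      fin_cases i
      · change c 0 * L ((spinRot g).comp X₁) 0 + _ * L ((spinRot g).comp X₂) 0 = c 0
        rw [hL₁, hL₂]; ring
      · change c 0 * L ((spinRot g).comp X₁) 1 + _ * L ((spinRot g).comp X₂) 1 = c 1
        rw [hL₃]; ring

/-! ### Plane rotations -/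

/-- The unit vector at angle `φ` from `e` in the plane of the orthonormal vectors `e` and `f`. -/
def planeDir {N : ℕ} {e f : USphere N} (hef : ⟪(e : Euc N), (f : Euc N)⟫_ℝ = 0) (φ : ℝ) :
    USphere N :=
  ⟨Real.cos φ • (e : Euc N) + Real.sin φ • (f : Euc N), by
    rw [mem_sphere_zero_iff_norm, ← sq_eq_sq₀ (norm_nonneg _) zero_le_one, norm_add_sq_real,
      norm_smul, norm_smul, e.norm_coe, f.norm_coe, real_inner_smul_left, real_inner_smul_right,
      hef, Real.norm_eq_abs, Real.norm_eq_abs, mul_one, mul_one, sq_abs, sq_abs]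
    linarith [Real.cos_sq_add_sin_sq φ]⟩

theorem coe_planeDir {N : ℕ} {e f : USphere N} (hef : ⟪(e : Euc N), (f : Euc N)⟫_ℝ = 0) (φ : ℝ) :
    (planeDir hef φ : Euc N) = Real.cos φ • (e : Euc N) + Real.sin φ • (f : Euc N) := rfl

/-- The element of the spin group that covers the rotation by `φ` in the plane of `e` and `f`. -/
def rotor {N : ℕ} {e f : USphere N} (hef : ⟪(e : Euc N), (f : Euc N)⟫_ℝ = 0) (φ : ℝ) : Spin N :=
  unitPair (planeDir hef (φ / 2)) (-e)

theorem continuous_rotor {N : ℕ} {e f : USphere N} (hef : ⟪(e : Euc N), (f : Euc N)⟫_ℝ = 0) :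
    Continuous (rotor hef) := by
  have h1 : Continuous fun φ : ℝ =>
      Real.cos (φ / 2) • (e : Euc N) + Real.sin (φ / 2) • (f : Euc N) :=
    by fun_prop
  have h2 : Continuous fun φ : ℝ => planeDir hef (φ / 2) := h1.subtype_mk _
  have h3 : Continuous fun φ : ℝ => (planeDir hef (φ / 2), -e) := h2.prodMk continuous_const
  refine (Continuous.comp (continuous_unitPair N) h3).congr fun φ => ?_
  rw [Function.comp_apply, rotor]

/-- The minus sign in the second factor of `rotor` matters here: e e = -1, whereas e (-e) = 1. -/
theorem rotor_zero {N : ℕ} {e f : USphere N} (hef : ⟪(e : Euc N), (f : Euc N)⟫_ℝ = 0) :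
    rotor hef 0 = 1 := by
  apply Subtype.ext
  change ι (stdForm N) (Real.cos (0 / 2) • (e : Euc N) + Real.sin (0 / 2) • (f : Euc N)) *
    ι (stdForm N) (-(e : Euc N)) = 1
  rw [zero_div, Real.cos_zero, Real.sin_zero, one_smul, zero_smul, add_zero, map_neg, mul_neg,
    ι_unit_sq e.norm_coe, neg_neg]

/-- The orthogonal projection to the plane of `e` and `f`. -/
def planeProj {N : ℕ} (e f : Euc N) : Euc N →L[ℝ] Euc N :=
  (innerSL ℝ e).smulRight e + (innerSL ℝ f).smulRight f

theorem planeProj_apply {N : ℕ} (e f z : Euc N) :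
    planeProj e f z = ⟪e, z⟫_ℝ • e + ⟪f, z⟫_ℝ • f := by
  simp [planeProj]

theorem spinRot_rotor_apply {N : ℕ} {e f : USphere N} (hef : ⟪(e : Euc N), (f : Euc N)⟫_ℝ = 0)
    (φ : ℝ) (z : Euc N) : spinRot (rotor hef φ) z =
      z + (Real.cos φ - 1) • (⟪(e : Euc N), z⟫_ℝ • (e : Euc N) + ⟪(f : Euc N), z⟫_ℝ • (f : Euc N)) +
        Real.sin φ • (⟪(e : Euc N), z⟫_ℝ • (f : Euc N) - ⟪(f : Euc N), z⟫_ℝ • (e : Euc N)) := by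
  obtain ⟨ψ, rfl⟩ : ∃ ψ, φ = 2 * ψ := ⟨φ / 2, by ring⟩
  have hψ : 2 * ψ / 2 = ψ := by ring
  have h1 : hyperRefl ((-e : USphere N) : Euc N) z =
      z - (2 * ⟪(e : Euc N), z⟫_ℝ) • (e : Euc N) := by
    rw [hyperRefl]
    change z - (2 * ⟪-(e : Euc N), z⟫_ℝ) • -(e : Euc N) = _
    rw [inner_neg_left]
    module
  have hfe : ⟪(f : Euc N), (e : Euc N)⟫_ℝ = 0 := by rw [real_inner_comm, hef]
  rw [rotor, spinRot_unitPair, h1, hyperRefl, coe_planeDir, hψ]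
  simp only [inner_add_left, inner_sub_right, real_inner_smul_left, real_inner_smul_right,
    e.inner_self, hfe]
  rw [Real.cos_two_mul, Real.sin_two_mul]
  have hs := Real.sin_sq_add_cos_sq ψ
  match_scalars
  · ring
  · linear_combination (0 : ℝ) * hs
  · linear_combination (-2 * ⟪(f : Euc N), z⟫_ℝ) * hs

theorem spinRot_rotor {N : ℕ} {e f : USphere N} (hef : ⟪(e : Euc N), (f : Euc N)⟫_ℝ = 0)
    (φ : ℝ) : spinRot (rotor hef φ) = ContinuousLinearMap.id ℝ (Euc N) +
      (Real.cos φ - 1) • planeProj (e : Euc N) f + Real.sin φ • wedgeOp (e : Euc N) f := by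
  ext1 z
  rw [spinRot_rotor_apply]
  simp only [add_apply, smul_apply, planeProj_apply, wedgeOp_apply, ContinuousLinearMap.id_apply]

/-- A plane rotation commutes with its generator. Both orders are recorded, so that in the
derivative of a product of two rotations both generators can be gathered between the factors. -/
theorem wedgeOp_comp_spinRot_rotor {N : ℕ} {e f : USphere N}
    (hef : ⟪(e : Euc N), (f : Euc N)⟫_ℝ = 0) (φ : ℝ) :
    (wedgeOp (e : Euc N) f).comp (spinRot (rotor hef φ)) =
      -Real.sin φ • planeProj (e : Euc N) f + Real.cos φ • wedgeOp (e : Euc N) f := by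
  have hfe : ⟪(f : Euc N), (e : Euc N)⟫_ℝ = 0 := by rw [real_inner_comm, hef]
  ext1 z
  simp only [add_apply, smul_apply, planeProj_apply, wedgeOp_apply, ContinuousLinearMap.comp_apply,
    spinRot_rotor_apply, inner_add_right, inner_sub_right, real_inner_smul_right, e.inner_self,
    f.inner_self, hef, hfe]
  module

theorem spinRot_rotor_comp_wedgeOp {N : ℕ} {e f : USphere N}
    (hef : ⟪(e : Euc N), (f : Euc N)⟫_ℝ = 0) (φ : ℝ) :
    (spinRot (rotor hef φ)).comp (wedgeOp (e : Euc N) f) =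
      -Real.sin φ • planeProj (e : Euc N) f + Real.cos φ • wedgeOp (e : Euc N) f := by
  have hfe : ⟪(f : Euc N), (e : Euc N)⟫_ℝ = 0 := by rw [real_inner_comm, hef]
  ext1 z
  simp only [add_apply, smul_apply, planeProj_apply, wedgeOp_apply, ContinuousLinearMap.comp_apply,
    spinRot_rotor_apply, inner_sub_right, real_inner_smul_right, e.inner_self,
    f.inner_self, hef, hfe]
  module

theorem hasDerivAt_spinRot_rotor {N : ℕ} {e f : USphere N}
    (hef : ⟪(e : Euc N), (f : Euc N)⟫_ℝ = 0) (θ t : ℝ) :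
    HasDerivAt (fun s => spinRot (rotor hef (s * θ)))
      (θ • (-Real.sin (t * θ) • planeProj (e : Euc N) f +
        Real.cos (t * θ) • wedgeOp (e : Euc N) f)) t := by
  have h0 : HasDerivAt (fun s : ℝ => s * θ) θ t := by
    simpa using (hasDerivAt_id t).mul_const θ
  have hc : HasDerivAt (fun s : ℝ => Real.cos (s * θ) - 1) (-Real.sin (t * θ) * θ) t :=
    h0.cos.sub_const 1
  have hs : HasDerivAt (fun s : ℝ => Real.sin (s * θ)) (Real.cos (t * θ) * θ) t := h0.sin
  simp only [spinRot_rotor]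
  have h := ((hc.smul_const (planeProj (e : Euc N) f)).const_add
    (ContinuousLinearMap.id ℝ (Euc N))).add (hs.smul_const (wedgeOp (e : Euc N) f))
  refine h.congr_deriv ?_
  module

theorem contDiff_spinRot_rotor {N : ℕ} {e f : USphere N}
    (hef : ⟪(e : Euc N), (f : Euc N)⟫_ℝ = 0) (θ : ℝ) :
    ContDiff ℝ 1 (fun s : ℝ => spinRot (rotor hef (s * θ))) := by
  simp only [spinRot_rotor]
  fun_prop

/-! ### The length of a product of two plane rotations -/

theorem trace_wedgeOp_comp {N : ℕ} (a b c d : Euc N) :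
    LinearMap.trace ℝ (Euc N) ((wedgeOp a b : Euc N →ₗ[ℝ] Euc N) ∘ₗ
      (wedgeOp c d : Euc N →ₗ[ℝ] Euc N)) =
      2 * (⟪a, d⟫_ℝ * ⟪b, c⟫_ℝ - ⟪b, d⟫_ℝ * ⟪a, c⟫_ℝ) := by
  have h : (wedgeOp a b : Euc N →ₗ[ℝ] Euc N) ∘ₗ (wedgeOp c d : Euc N →ₗ[ℝ] Euc N) =
      (innerₗ (Euc N) c).smulRight (wedgeOp a b d) -
        (innerₗ (Euc N) d).smulRight (wedgeOp a b c) := by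
    ext1 z
    simp [wedgeOp_apply c d]
  rw [h, map_sub, LinearMap.trace_smulRight, LinearMap.trace_smulRight, innerₗ_apply_apply,
    innerₗ_apply_apply, wedgeOp_apply, wedgeOp_apply]
  simp only [inner_sub_right, real_inner_smul_right, real_inner_comm c, real_inner_comm d]
  ring

theorem neg_half_trace_le {N : ℕ} {e f e' f' : USphere N}
    (hef : ⟪(e : Euc N), (f : Euc N)⟫_ℝ = 0) (hef' : ⟪(e' : Euc N), (f' : Euc N)⟫_ℝ = 0)
    (θ θ' : ℝ) {T : Euc N →ₗ[ℝ] Euc N}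
    (hT : T = θ • (wedgeOp (e : Euc N) f : Euc N →ₗ[ℝ] Euc N) +
      θ' • (wedgeOp (e' : Euc N) f' : Euc N →ₗ[ℝ] Euc N)) :
    -(1 / 2) * LinearMap.trace ℝ (Euc N) (T ∘ₗ T) ≤ (2 * (|θ| + |θ'|)) ^ 2 := by
  have hb := USphere.abs_inner_le_one (N := N)
  have hfe : ⟪(f : Euc N), (e : Euc N)⟫_ℝ = 0 := by rw [real_inner_comm, hef]
  have hfe' : ⟪(f' : Euc N), (e' : Euc N)⟫_ℝ = 0 := by rw [real_inner_comm, hef']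
  rw [hT]
  simp only [LinearMap.add_comp, LinearMap.comp_add, LinearMap.smul_comp, LinearMap.comp_smul,
    map_add, map_smul, trace_wedgeOp_comp, hef, hef', hfe, hfe', e.inner_self, f.inner_self,
    e'.inner_self, f'.inner_self, smul_eq_mul]
  rw [real_inner_comm (e' : Euc N) f, real_inner_comm (e' : Euc N) e,
    real_inner_comm (f' : Euc N) e, real_inner_comm (f' : Euc N) f]
  obtain ⟨c, hc⟩ : ∃ c, c = ⟪(f' : Euc N), (e : Euc N)⟫_ℝ * ⟪(e' : Euc N), (f : Euc N)⟫_ℝ -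
      ⟪(f' : Euc N), (f : Euc N)⟫_ℝ * ⟪(e' : Euc N), (e : Euc N)⟫_ℝ := ⟨_, rfl⟩
  -- A crude bound on the cross term by products of entries of modulus at most 1; only a bound
  -- linear in the angles is needed for the speed.
  have hc2 : |c| ≤ 2 := by
    rw [hc]
    refine (abs_sub _ _).trans ?_
    rw [abs_mul, abs_mul]
    have h1 := mul_le_one₀ (hb f' e) (abs_nonneg _) (hb e' f)
    have h2 := mul_le_one₀ (hb f' f) (abs_nonneg _) (hb e' e)
    linarith
  have h3 : -(2 * (θ * θ' * c)) ≤ 4 * (|θ| * |θ'|) := by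
    have h4 : |θ * θ' * c| ≤ |θ| * |θ'| * 2 := by
      rw [abs_mul, abs_mul]
      gcongr
    have h5 := neg_abs_le (θ * θ' * c)
    linarith
  have h6 : 0 ≤ |θ| * |θ'| := by positivity
  have h7 : (2 * (|θ| + |θ'|)) ^ 2 = 4 * θ ^ 2 + 8 * (|θ| * |θ'|) + 4 * θ' ^ 2 := by
    rw [← sq_abs θ, ← sq_abs θ']; ring
  rw [h7]
  refine le_trans (b := θ ^ 2 + θ' ^ 2 + -(2 * (θ * θ' * c))) (le_of_eq ?_) ?_
  · rw [hc]; ring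
  · linarith [sq_nonneg θ, sq_nonneg θ']

theorem trace_conj_spinRot {N : ℕ} (k : Spin N) (T : Euc N →L[ℝ] Euc N) {X : Euc N →ₗ[ℝ] Euc N}
    (hX : X = ((spinRot k⁻¹).comp (T.comp (spinRot k)) : Euc N →L[ℝ] Euc N)) :
    LinearMap.trace ℝ (Euc N) (X ∘ₗ X) =
      LinearMap.trace ℝ (Euc N) ((T : Euc N →ₗ[ℝ] Euc N) ∘ₗ (T : Euc N →ₗ[ℝ] Euc N)) := by
  have h : X ∘ₗ X = (spinRot k⁻¹ : Euc N →ₗ[ℝ] Euc N) ∘ₗ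
      (((T : Euc N →ₗ[ℝ] Euc N) ∘ₗ (T : Euc N →ₗ[ℝ] Euc N)) ∘ₗ
        (spinRot k : Euc N →ₗ[ℝ] Euc N)) := by
    rw [hX]
    ext1 z
    simp [spinRot_apply_inv_self]
  rw [h, LinearMap.trace_comp_comm', LinearMap.comp_assoc]
  congr 1
  ext1 z
  simp [spinRot_apply_inv_self]

/-- Letting both angles grow simultaneously gives a single smooth curve, with no corner to round
off. Its logarithmic velocity is conjugate to the constant combination T of the two generators, and
the trace is invariant under conjugation. -/
theorem spinDist_rotor_mul_rotor_mul_le {N : ℕ} {e f e' f' : USphere N}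
    (hef : ⟪(e : Euc N), (f : Euc N)⟫_ℝ = 0) (hef' : ⟪(e' : Euc N), (f' : Euc N)⟫_ℝ = 0)
    (θ θ' : ℝ) (g : Spin N) :
    spinDist N g (rotor hef' θ' * (rotor hef θ * g)) ≤ ENNReal.ofReal (2 * (|θ| + |θ'|)) := by
  let γ : ℝ → Spin N := fun t => rotor hef' (t * θ') * (rotor hef (t * θ) * g)
  have hR : (fun s => spinRot (γ s)) = fun s => (spinRot (rotor hef' (s * θ'))).comp
      ((spinRot (rotor hef (s * θ))).comp (spinRot g)) := by
    funext s
    rw [← spinRot_mul, ← spinRot_mul]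
  have hcont : Continuous γ := by
    have h1 : Continuous fun t : ℝ => rotor hef' (t * θ') :=
      (continuous_rotor hef').comp (continuous_mul_const θ')
    have h2 : Continuous fun t : ℝ => rotor hef (t * θ) :=
      (continuous_rotor hef).comp (continuous_mul_const θ)
    exact h1.mul (h2.mul continuous_const)
  have hC1 : IsC1Curve γ := by
    refine ⟨hcont.continuousOn, ?_⟩
    rw [hR]
    exact ((contDiff_spinRot_rotor hef' θ').clm_comp
      ((contDiff_spinRot_rotor hef θ).clm_comp contDiff_const)).contDiffOn
  have h0 : γ 0 = g := by
    change rotor hef' (0 * θ') * (rotor hef (0 * θ) * g) = g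
    rw [zero_mul, zero_mul, rotor_zero, rotor_zero, one_mul, one_mul]
  have h1 : γ 1 = rotor hef' θ' * (rotor hef θ * g) := by
    change rotor hef' (1 * θ') * (rotor hef (1 * θ) * g) = _
    rw [one_mul, one_mul]
  have hspeed : ∀ t ∈ Icc (0 : ℝ) 1, spinSpeed γ t ≤ 2 * (|θ| + |θ'|) := by
    intro t ht
    obtain ⟨T, hT⟩ : ∃ T : Euc N →L[ℝ] Euc N,
        T = θ • wedgeOp (e : Euc N) f + θ' • wedgeOp (e' : Euc N) f' := ⟨_, rfl⟩
    obtain ⟨k, hk⟩ : ∃ k : Spin N, k = rotor hef (t * θ) * g := ⟨_, rfl⟩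
    have hderiv : derivWithin (fun s => spinRot (γ s)) (Icc 0 1) t =
        (spinRot (γ t)).comp ((spinRot k⁻¹).comp (T.comp (spinRot k))) := by
      rw [hR]
      have hd := (hasDerivAt_spinRot_rotor hef' θ' t).clm_comp
        ((hasDerivAt_spinRot_rotor hef θ t).clm_comp (hasDerivAt_const t (spinRot g)))
      rw [(hd.hasDerivWithinAt (s := Icc 0 1)).derivWithin
        (uniqueDiffOn_Icc zero_lt_one t ht), ← wedgeOp_comp_spinRot_rotor hef,
        ← spinRot_rotor_comp_wedgeOp hef']
      ext1 z
      change _ = spinRot (rotor hef' (t * θ') * (rotor hef (t * θ) * g))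
        (spinRot k⁻¹ (T (spinRot k z)))
      rw [← hk, spinRot_mul_apply, spinRot_apply_inv_self, hT, hk, spinRot_mul_apply]
      simp only [add_apply, smul_apply, ContinuousLinearMap.comp_apply, map_add, map_smul,
        zero_apply, map_zero, add_zero]
      exact add_comm _ _
    have htr := trace_conj_spinRot k T (X := ((spinRot (γ t)⁻¹).comp
      (derivWithin (fun s => spinRot (γ s)) (Icc 0 1) t) : Euc N →L[ℝ] Euc N)) (by
        rw [hderiv]
        ext1 z
        simp [spinRot_inv_apply_self])
    refine Real.sqrt_le_iff.2 ⟨by positivity, ?_⟩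
    rw [htr]
    refine neg_half_trace_le hef hef' θ θ' ?_
    rw [hT]
    rfl
  calc spinDist N g (rotor hef' θ' * (rotor hef θ * g))
      ≤ ∫⁻ t in Icc (0 : ℝ) 1, ENNReal.ofReal (spinSpeed γ t) :=
        iInf₂_le (f := fun (γ : ℝ → Spin N) (_ : IsC1Curve γ ∧ γ 0 = g ∧ γ 1 = _) =>
          ∫⁻ t in Icc (0 : ℝ) 1, ENNReal.ofReal (spinSpeed γ t)) γ ⟨hC1, h0, h1⟩
    _ ≤ ∫⁻ _ in Icc (0 : ℝ) 1, ENNReal.ofReal (2 * (|θ| + |θ'|)) :=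
        setLIntegral_mono measurable_const fun t ht => ENNReal.ofReal_le_ofReal (hspeed t ht)
    _ = ENNReal.ofReal (2 * (|θ| + |θ'|)) := by simp

/-! ### Concentration near the preimage of a bi-equator -/

/-- The coefficients of the projection and of the generator are at most |θ| / 2 and |θ|, and each
multiplies a quantity of modulus at most 2. -/
theorem abs_inner_spinRot_rotor_le {N : ℕ} {e f : USphere N}
    (hef : ⟪(e : Euc N), (f : Euc N)⟫_ℝ = 0) {θ : ℝ} (hθ : |θ| ≤ 1) (a b : USphere N) :
    |⟪(a : Euc N), spinRot (rotor hef θ) b⟫_ℝ| ≤ |⟪(a : Euc N), (b : Euc N)⟫_ℝ| + 3 * |θ| := by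
  have hprod : ∀ c d c' d' : USphere N,
      |⟪(c : Euc N), (d : Euc N)⟫_ℝ * ⟪(c' : Euc N), (d' : Euc N)⟫_ℝ| ≤ 1 := by
    intro c d c' d'
    rw [abs_mul]
    exact mul_le_one₀ (c.abs_inner_le_one d) (abs_nonneg _) (c'.abs_inner_le_one d')
  have hcos : |Real.cos θ - 1| ≤ |θ| / 2 := by
    rw [abs_sub_comm, abs_of_nonneg (by linarith [Real.cos_le_one θ])]
    have h1 := Real.one_sub_sq_div_two_le_cos (x := θ)
    have h2 : θ ^ 2 ≤ |θ| := by
      rw [← sq_abs]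
      nlinarith [abs_nonneg θ]
    linarith
  have hsin : |Real.sin θ| ≤ |θ| := Real.abs_sin_le_abs
  rw [spinRot_rotor_apply]
  simp only [inner_add_right, inner_sub_right, real_inner_smul_right]
  obtain ⟨P, hP⟩ : ∃ P, P = ⟪(e : Euc N), (b : Euc N)⟫_ℝ * ⟪(a : Euc N), (e : Euc N)⟫_ℝ +
      ⟪(f : Euc N), (b : Euc N)⟫_ℝ * ⟪(a : Euc N), (f : Euc N)⟫_ℝ := ⟨_, rfl⟩
  obtain ⟨J, hJ⟩ : ∃ J, J = ⟪(e : Euc N), (b : Euc N)⟫_ℝ * ⟪(a : Euc N), (f : Euc N)⟫_ℝ -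
      ⟪(f : Euc N), (b : Euc N)⟫_ℝ * ⟪(a : Euc N), (e : Euc N)⟫_ℝ := ⟨_, rfl⟩
  have hP2 : |P| ≤ 2 := by
    rw [hP]
    exact (abs_add_le _ _).trans (by linarith [hprod e b a e, hprod f b a f])
  have hJ2 : |J| ≤ 2 := by
    rw [hJ]
    exact (abs_sub _ _).trans (by linarith [hprod e b a f, hprod f b a e])
  rw [← hP, ← hJ]
  have h1 : |(Real.cos θ - 1) * P| ≤ |θ| / 2 * 2 := by
    rw [abs_mul]
    gcongr
  have h2 : |Real.sin θ * J| ≤ |θ| * 2 := by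
    rw [abs_mul]
    gcongr
  refine (abs_add_le _ _).trans ?_
  linarith [abs_add_le ⟪(a : Euc N), (b : Euc N)⟫_ℝ ((Real.cos θ - 1) * P)]

/-- A unit vector that is almost orthogonal to `u` becomes orthogonal to `u` after a rotation by
a small angle. -/
theorem exists_rotor_orthogonal {N : ℕ} (u x : USphere N)
    (h : |⟪(u : Euc N), (x : Euc N)⟫_ℝ| ≤ 1 / 2) :
    ∃ (e f : USphere N) (hef : ⟪(e : Euc N), (f : Euc N)⟫_ℝ = 0) (θ : ℝ),
      |θ| ≤ 2 * |⟪(u : Euc N), (x : Euc N)⟫_ℝ| ∧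
      ⟪(u : Euc N), spinRot (rotor hef θ) x⟫_ℝ = 0 ∧
      ∀ z, ⟪(u : Euc N), z⟫_ℝ = 0 → ⟪(x : Euc N), z⟫_ℝ = 0 → spinRot (rotor hef θ) z = z := by
  obtain ⟨s, hs⟩ : ∃ s, s = ⟪(u : Euc N), (x : Euc N)⟫_ℝ := ⟨_, rfl⟩
  rw [← hs] at h ⊢
  have hs2 : s ^ 2 ≤ 1 / 4 := by
    rw [← sq_abs]
    nlinarith [abs_nonneg s]
  obtain ⟨r, hr⟩ : ∃ r, r = √(1 - s ^ 2) := ⟨_, rfl⟩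
  have hr2 : r ^ 2 = 1 - s ^ 2 := by rw [hr, Real.sq_sqrt (by linarith)]
  have hr0 : 0 < r := by rw [hr]; exact Real.sqrt_pos.2 (by linarith)
  have hnorm : ‖(x : Euc N) - s • (u : Euc N)‖ = r := by
    rw [← sq_eq_sq₀ (norm_nonneg _) hr0.le, norm_sub_sq_real, norm_smul, mul_pow, x.norm_coe,
      u.norm_coe, real_inner_smul_right, real_inner_comm, ← hs, Real.norm_eq_abs, sq_abs, hr2]
    ring
  let e : USphere N := ⟨r⁻¹ • ((x : Euc N) - s • (u : Euc N)), by
    rw [mem_sphere_zero_iff_norm, norm_smul, hnorm, norm_inv, Real.norm_eq_abs, abs_of_pos hr0,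
      inv_mul_cancel₀ hr0.ne']⟩
  have he : (e : Euc N) = r⁻¹ • ((x : Euc N) - s • (u : Euc N)) := rfl
  have heu : ⟪(e : Euc N), (u : Euc N)⟫_ℝ = 0 := by
    rw [he, real_inner_smul_left, inner_sub_left, real_inner_smul_left, u.inner_self,
      real_inner_comm, ← hs, mul_one, sub_self, mul_zero]
  have hex : ⟪(e : Euc N), (x : Euc N)⟫_ℝ = r := by
    rw [he, real_inner_smul_left, inner_sub_left, real_inner_smul_left, x.inner_self, ← hs]
    field_simp
    linarith
  have hs1 : -1 ≤ -s ∧ -s ≤ 1 := by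
    constructor <;> nlinarith
  -- As x = r e + s u, the u-component after rotation by θ is s cos θ + r sin θ; it vanishes for sin
  -- θ = -s, cos θ = r. Jordan's inequality and π ≤ 4 give |θ| ≤ 2 |s|.
  refine ⟨e, u, heu, Real.arcsin (-s), ?_, ?_, fun z hu hx => ?_⟩
  · have h1 := Real.mul_abs_le_abs_sin (abs_le.2
      ⟨Real.neg_pi_div_two_le_arcsin (-s), Real.arcsin_le_pi_div_two (-s)⟩)
    rw [Real.sin_arcsin hs1.1 hs1.2, abs_neg] at h1
    have h2 : 1 / 2 ≤ 2 / Real.pi := by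
      rw [div_le_div_iff₀ two_pos Real.pi_pos]
      linarith [Real.pi_le_four]
    nlinarith [abs_nonneg (Real.arcsin (-s))]
  · rw [spinRot_rotor_apply]
    simp only [inner_add_right, inner_sub_right, real_inner_smul_right]
    rw [u.inner_self, real_inner_comm (e : Euc N) u, heu, hex, ← hs, Real.sin_arcsin hs1.1 hs1.2,
      Real.cos_arcsin, neg_sq, ← hr]
    ring
  · have hez : ⟪(e : Euc N), z⟫_ℝ = 0 := by
      rw [he, real_inner_smul_left, inner_sub_left, real_inner_smul_left, hu, hx]
      simp
    rw [spinRot_rotor_apply, hez, hu]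
    simp

/-- A first rotation makes x orthogonal to u, and a second, in the plane of w and y₁ and hence
fixing x₁, makes y₁ orthogonal to w. Smallness of ⟨p, x⟩ keeps x₁ away from -p, and smallness of ⟨p,
y⟩ controls the correction term of `rotateBack`. The angles are at most 2δ and 42δ, so the distance
is at most 88δ < 100δ. -/
theorem mem_tube_preimage_biequator {m : ℕ} (u : USphere (m + 2)) (v : USphere (m + 1))
    {δ : ℝ} (hδ : 0 < δ) (hδ' : δ ≤ 1 / 42) (g : Spin (m + 2))
    (h1 : |⟪(u : Euc (m + 2)), spinRot g (pole (m + 1))⟫_ℝ| < δ)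
    (h2 : |⟪(pole (m + 1) : Euc (m + 2)), spinRot g (pole (m + 1))⟫_ℝ| < δ)
    (h3 : |⟪(padSphere v : Euc (m + 2)), spinRot g (padSphere (pole m))⟫_ℝ| < δ)
    (h4 : |⟪(pole (m + 1) : Euc (m + 2)), spinRot g (padSphere (pole m))⟫_ℝ| < δ) :
    g ∈ tube (spinDist (m + 2)) (baseProj m ⁻¹' (equator u ×ˢ equator v)) (100 * δ) := by
  obtain ⟨p, hp⟩ : ∃ p : USphere (m + 2), p = pole (m + 1) := ⟨_, rfl⟩
  obtain ⟨x, hx⟩ : ∃ x : USphere (m + 2), x = spinAct g (pole (m + 1)) := ⟨_, rfl⟩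
  obtain ⟨y, hy⟩ : ∃ y : USphere (m + 2), y = spinAct g (padSphere (pole m)) := ⟨_, rfl⟩
  rw [← coe_spinAct, ← hx] at h1 h2
  rw [← coe_spinAct, ← hy] at h3 h4
  have hxy : ⟪(x : Euc (m + 2)), (y : Euc (m + 2))⟫_ℝ = 0 := by
    rw [hx, hy, coe_spinAct, coe_spinAct, spinRot_inner, coe_padSphere, inner_pole_pad]
  obtain ⟨e, f, hef, θ, hθ, hux, -⟩ := exists_rotor_orthogonal u x (by linarith)
  have hθ2 : |θ| ≤ 2 * δ := by linarith
  have hθ1 : |θ| ≤ 1 := by linarith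
  obtain ⟨x₁, hx₁⟩ : ∃ x₁ : USphere (m + 2), x₁ = spinAct (rotor hef θ) x := ⟨_, rfl⟩
  obtain ⟨y₁, hy₁⟩ : ∃ y₁ : USphere (m + 2), y₁ = spinAct (rotor hef θ) y := ⟨_, rfl⟩
  have hxy₁ : ⟪(x₁ : Euc (m + 2)), (y₁ : Euc (m + 2))⟫_ℝ = 0 := by
    rw [hx₁, hy₁, coe_spinAct, coe_spinAct, spinRot_inner, hxy]
  rw [← coe_spinAct, ← hx₁] at hux
  have hpx : |⟪(pole (m + 1) : Euc (m + 2)), (x₁ : Euc (m + 2))⟫_ℝ| ≤ 7 * δ := by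
    rw [hx₁, coe_spinAct]
    exact (abs_inner_spinRot_rotor_le hef hθ1 _ _).trans (by linarith)
  have hvy : |⟪(padSphere v : Euc (m + 2)), (y₁ : Euc (m + 2))⟫_ℝ| ≤ 7 * δ := by
    rw [hy₁, coe_spinAct]
    exact (abs_inner_spinRot_rotor_le hef hθ1 _ _).trans (by linarith)
  have hpy : |⟪(pole (m + 1) : Euc (m + 2)), (y₁ : Euc (m + 2))⟫_ℝ| ≤ 7 * δ := by
    rw [hy₁, coe_spinAct]
    exact (abs_inner_spinRot_rotor_le hef hθ1 _ _).trans (by linarith)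
  have hpos : 1 / 2 ≤ 1 + ⟪(pole (m + 1) : Euc (m + 2)), (x₁ : Euc (m + 2))⟫_ℝ := by
    linarith [neg_abs_le ⟪(pole (m + 1) : Euc (m + 2)), (x₁ : Euc (m + 2))⟫_ℝ]
  have h0 : (pole (m + 1) : Euc (m + 2)) + x₁ ≠ 0 := by
    intro h
    have h5 : ⟪(pole (m + 1) : Euc (m + 2)), (pole (m + 1) : Euc (m + 2)) + x₁⟫_ℝ = 0 := by
      rw [h, inner_zero_right]
    rw [inner_add_right, (pole (m + 1)).inner_self] at h5
    linarith
  obtain ⟨w, hw⟩ : ∃ w : USphere (m + 2), w = spinAct (turn (pole (m + 1)) x₁) (padSphere v) :=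
    ⟨_, rfl⟩
  have hwrot : ∀ z : Euc (m + 2), ⟪(x₁ : Euc (m + 2)), z⟫_ℝ = 0 →
      ⟪(v : Euc (m + 1)), rotateBack m x₁ z⟫_ℝ = ⟪(w : Euc (m + 2)), z⟫_ℝ := by
    intro z hz
    rw [inner_rotateBack_eq _ h0 hz, hw, coe_spinAct, coe_padSphere]
  have hwx : ⟪(w : Euc (m + 2)), (x₁ : Euc (m + 2))⟫_ℝ = 0 := by
    rw [real_inner_comm, hw, coe_spinAct, coe_padSphere, inner_spinRot_turn_pad h0]
  -- The main term contributes 7δ and the correction 7δ / (1/2) = 14δ. The assumption δ ≤ 1/42 is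
  -- what brings 21δ below the 1/2 required for the second rotation.
  have hwy : |⟪(w : Euc (m + 2)), (y₁ : Euc (m + 2))⟫_ℝ| ≤ 21 * δ := by
    rw [← hwrot _ hxy₁, inner_rotateBack]
    refine (abs_sub _ _).trans ?_
    have h5 : |⟪(pole (m + 1) : Euc (m + 2)), (y₁ : Euc (m + 2))⟫_ℝ /
        (1 + ⟪(pole (m + 1) : Euc (m + 2)), (x₁ : Euc (m + 2))⟫_ℝ)| ≤ 14 * δ := by
      rw [abs_div, abs_of_pos (by linarith :
        0 < 1 + ⟪(pole (m + 1) : Euc (m + 2)), (x₁ : Euc (m + 2))⟫_ℝ), div_le_iff₀ (by linarith)]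
      nlinarith
    have h6 : |⟪(padSphere v : Euc (m + 2)), (x₁ : Euc (m + 2))⟫_ℝ| ≤ 1 :=
      USphere.abs_inner_le_one _ _
    rw [abs_mul]
    rw [coe_padSphere] at hvy h6
    have h7 := mul_le_mul h5 h6 (abs_nonneg _) (by linarith)
    linarith
  obtain ⟨e', f', hef', θ', hθ', hwy', hfix⟩ := exists_rotor_orthogonal w y₁ (by linarith)
  have hx₂ : spinRot (rotor hef' θ') (x₁ : Euc (m + 2)) = x₁ :=
    hfix _ hwx (by rw [real_inner_comm, hxy₁])
  refine ⟨rotor hef' θ' * (rotor hef θ * g), mem_preimage_biequator_iff.2 ?_,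
    (spinDist_rotor_mul_rotor_mul_le hef hef' θ θ' g).trans_lt ?_⟩
  · have h5 : spinRot (rotor hef' θ' * (rotor hef θ * g)) (pole (m + 1)) = x₁ := by
      rw [spinRot_mul_apply, spinRot_mul_apply]
      rw [hx₁, coe_spinAct, hx, coe_spinAct] at hx₂
      rw [hx₂, hx₁, coe_spinAct, hx, coe_spinAct]
    have h6 : spinRot (rotor hef' θ' * (rotor hef θ * g)) (pad (m + 1) (pole m)) =
        spinRot (rotor hef' θ') y₁ := by
      rw [spinRot_mul_apply, spinRot_mul_apply, hy₁, coe_spinAct, hy, coe_spinAct, coe_padSphere]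
    rw [h5, h6]
    refine ⟨hux, ?_⟩
    rw [hwrot _ (by rw [← hx₂, spinRot_inner, hxy₁]), hwy']
  · rw [ENNReal.ofReal_lt_ofReal_iff (by linarith)]
    linarith

theorem measure_compl_tube_le {m : ℕ} (μ : Measure (Spin (m + 2))) [μ.IsMulLeftInvariant]
    [IsProbabilityMeasure μ] (u : USphere (m + 2)) (v : USphere (m + 1))
    {δ : ℝ} (hδ : 0 < δ) (hδ' : δ ≤ 1 / 42) :
    μ (tube (spinDist (m + 2)) (baseProj m ⁻¹' (equator u ×ˢ equator v)) (100 * δ))ᶜ ≤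
      4 * ENNReal.ofReal (((m + 2 : ℕ) * δ ^ 2 : ℝ)⁻¹) := by
  let A : USphere (m + 2) → USphere (m + 2) → Set (Spin (m + 2)) := fun a b =>
    {g | δ ≤ |⟪(a : Euc (m + 2)), spinRot g b⟫_ℝ|}
  have hsub : (tube (spinDist (m + 2)) (baseProj m ⁻¹' (equator u ×ˢ equator v)) (100 * δ))ᶜ ⊆
      (A u (pole (m + 1)) ∪ A (pole (m + 1)) (pole (m + 1))) ∪
        (A (padSphere v) (padSphere (pole m)) ∪ A (pole (m + 1)) (padSphere (pole m))) := by
    intro g hg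
    by_contra hn
    simp only [mem_union, not_or, A, mem_ofPred_eq, not_le] at hn
    exact hg (mem_tube_preimage_biequator u v hδ hδ' g hn.1.1 hn.1.2 hn.2.1 hn.2.2)
  have hA : ∀ a b, μ (A a b) ≤ ENNReal.ofReal (((m + 2 : ℕ) * δ ^ 2 : ℝ)⁻¹) := fun a b =>
    measure_inner_spinRot_ge_le μ a b hδ
  calc _ ≤ _ := measure_mono hsub
    _ ≤ _ := measure_union_le _ _
    _ ≤ _ := add_le_add (measure_union_le _ _) (measure_union_le _ _)
    _ ≤ _ := add_le_add (add_le_add (hA _ _) (hA _ _)) (add_le_add (hA _ _) (hA _ _))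
    _ = _ := by ring

/-- The first equation alone cuts out a closed set, which avoids the fibre over -p because -p is off
the equator. The second equation is continuous on that set. -/
theorem isClosed_preimage_biequator {m : ℕ} {u : USphere (m + 2)} (v : USphere (m + 1))
    (hu : -pole (m + 1) ∉ equator u) :
    IsClosed (baseProj m ⁻¹' (equator u ×ˢ equator v)) := by
  have hE : IsClosed {g : Spin (m + 2) | ⟪(u : Euc (m + 2)), spinRot g (pole (m + 1))⟫_ℝ = 0} :=
    isClosed_eq (continuous_const.inner (continuous_spinRot_const _)) continuous_const
  have hreg : ∀ g : Spin (m + 2), ⟪(u : Euc (m + 2)), spinRot g (pole (m + 1))⟫_ℝ = 0 →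
      1 + ⟪(pole (m + 1) : Euc (m + 2)), spinRot g (pole (m + 1))⟫_ℝ ≠ 0 := by
    intro g hg
    have h0 : baseProj m g ∈ regularBase m := fun h => hu (h ▸ hg)
    have h1 := one_add_inner_ne_zero (mem_regularBase_iff.1 h0)
    rwa [baseProj_fst] at h1
  have hc : ContinuousOn (fun g : Spin (m + 2) => ⟪(v : Euc (m + 1)),
      rotateBack m (spinRot g (pole (m + 1))) (spinRot g (pad (m + 1) (pole m)))⟫_ℝ)
      {g : Spin (m + 2) | ⟪(u : Euc (m + 2)), spinRot g (pole (m + 1))⟫_ℝ = 0} :=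
    ContinuousOn.inner continuousOn_const (continuousOn_rotateBack
      (continuous_spinRot_const _).continuousOn (continuous_spinRot_const _).continuousOn hreg)
  exact hc.preimage_isClosed_of_isClosed hE isClosed_singleton

theorem preimage_biequator_ne_univ {m : ℕ} (u : USphere (m + 2)) (v : USphere (m + 1)) :
    baseProj m ⁻¹' (equator u ×ˢ equator v) ≠ univ := by
  intro h
  obtain ⟨g, hg⟩ := exists_spinRot_pole u
  have h1 : g ∈ baseProj m ⁻¹' (equator u ×ˢ equator v) := by rw [h]; trivial
  have h2 := (mem_preimage_biequator_iff.1 h1).1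
  rw [hg, u.inner_self] at h2
  exact one_ne_zero h2

theorem concentratesOn_preimage_biequator {μ : ∀ n : ℕ, Measure (Spin (2 * n + 2))}
    (hμ : ∀ n, IsNormalisedInvariant (μ n)) (u : ∀ n : ℕ, USphere (2 * n + 2))
    (v : ∀ n : ℕ, USphere (2 * n + 1))
    (hu : ∀ n, 1 ≤ n → -pole (2 * n + 1) ∉ equator (u n)) :
    ConcentratesOn (fun n => Spin (2 * n + 2)) (fun n => spinDist (2 * n + 2)) μ
      (fun n => baseProj (2 * n) ⁻¹' (equator (u n) ×ˢ equator (v n))) where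
  connected n _ := Spin.connectedSpace (by omega)
  normalised n _ := (hμ n).isProbabilityMeasure
  openPos n _ := by
    have := (hμ n).isProbabilityMeasure
    have := (hμ n).isMulLeftInvariant
    exact (isHaarMeasure_of_isProbabilityMeasure (μ n)).toIsOpenPosMeasure
  closed n hn := isClosed_preimage_biequator (v n) (hu n hn)
  proper n _ := preimage_biequator_ne_univ (u n) (v n)
  concentrates := by
    -- With N = 2n + 2 this is N^(-1/4), so N δ² = √N: the radius and the Chebyshev bound both tend
    -- to zero.
    let δ : ℕ → ℝ := fun n => (√√((2 * n + 2 : ℕ) : ℝ))⁻¹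
    have hN : Tendsto (fun n : ℕ => ((2 * n + 2 : ℕ) : ℝ)) atTop atTop :=
      tendsto_natCast_atTop_atTop.comp (tendsto_atTop_mono (fun n => by rw [id]; omega) tendsto_id)
    have hsqrt := Real.tendsto_sqrt_atTop.comp hN
    have hδ : Tendsto δ atTop (𝓝 0) :=
      tendsto_inv_atTop_zero.comp (Real.tendsto_sqrt_atTop.comp hsqrt)
    have hδpos : ∀ n, 0 < δ n := fun n => by positivity
    have hδsq : ∀ n, ((2 * n + 2 : ℕ) : ℝ) * δ n ^ 2 = √((2 * n + 2 : ℕ) : ℝ) := by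
      intro n
      have h1 : √((2 * n + 2 : ℕ) : ℝ) ≠ 0 := by positivity
      have h2 : δ n ^ 2 = (√((2 * n + 2 : ℕ) : ℝ))⁻¹ := by
        rw [inv_pow, Real.sq_sqrt (Real.sqrt_nonneg _)]
      rw [h2, ← div_eq_mul_inv, Real.div_sqrt]
    refine ⟨fun n => 100 * δ n, fun n => by linarith [hδpos n], ?_, ?_⟩
    · simpa using hδ.const_mul 100
    · have hlim : Tendsto (fun n : ℕ => 4 * ENNReal.ofReal (√((2 * n + 2 : ℕ) : ℝ))⁻¹) atTop
          (𝓝 0) := by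
        have h1 := ENNReal.tendsto_ofReal (tendsto_inv_atTop_zero.comp hsqrt)
        rw [ENNReal.ofReal_zero] at h1
        have h2 := ENNReal.Tendsto.const_mul (a := 4) h1 (Or.inr (by simp))
        rwa [mul_zero] at h2
      refine tendsto_of_tendsto_of_tendsto_of_le_of_le' tendsto_const_nhds hlim
        (Eventually.of_forall fun n => zero_le) ?_
      -- The tube estimate is available only once δ ≤ 1/42, hence for large n.
      filter_upwards [hδ.eventually_le_const (by norm_num : (0 : ℝ) < 1 / 42)] with n hn
      have := (hμ n).isProbabilityMeasure
      have := (hμ n).isMulLeftInvariant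
      rw [← hδsq n]
      exact measure_compl_tube_le (μ n) (u n) (v n) (hδpos n) hn

theorem mainTheorem5 :
    (∀ n : ℕ, 1 ≤ n →
      IsPrincipalBundleOver (spinIncl (2 * n)) (frameProj (2 * n)) univ ∧
      IsPrincipalBundleOver (spinIncl (2 * n)) (baseProj (2 * n)) (regularBase (2 * n))) ∧
    ∃ μ : ∀ n : ℕ, Measure (Spin (2 * n + 2)),
      (∀ n, 1 ≤ n → IsNormalisedInvariant (μ n) ∧
        (∀ ν : Measure (Spin (2 * n + 2)), IsNormalisedInvariant ν → ν = μ n) ∧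
        μ n (baseProj (2 * n) ⁻¹' (regularBase (2 * n))ᶜ) = 0) ∧
      ∀ (u : ∀ n : ℕ, USphere (2 * n + 2)) (v : ∀ n : ℕ, USphere (2 * n + 1)),
        (∀ n, 1 ≤ n → -pole (2 * n + 1) ∉ equator (u n)) →
        (∀ n, 1 ≤ n →
          IsSpinSubmanifold 2 (baseProj (2 * n) ⁻¹' (equator (u n) ×ˢ equator (v n)))) ∧
        ConcentratesOn (fun n => Spin (2 * n + 2)) (fun n => spinDist (2 * n + 2)) μ
          (fun n => baseProj (2 * n) ⁻¹' (equator (u n) ×ˢ equator (v n))) := by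
  refine ⟨fun n hn => ?_, fun n => Measure.haarMeasure ⊤, fun n _ => ?_, fun u v hu => ⟨fun n hn =>
    isSpinSubmanifold_preimage_biequator (v n) (hu n hn),
    concentratesOn_preimage_biequator (fun n => isNormalisedInvariant_haarMeasure_top) u v hu⟩⟩
  · have : NeZero (2 * n) := ⟨by omega⟩
    exact ⟨isPrincipalBundleOver_frameProj (2 * n), isPrincipalBundleOver_baseProj (2 * n)⟩
  · have hinv := isNormalisedInvariant_haarMeasure_top (G := Spin (2 * n + 2))
    have := hinv.isProbabilityMeasure
    have := hinv.isMulLeftInvariant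
    exact ⟨hinv, fun ν hν => hν.eq_haarMeasure_top, measure_preimage_compl_regularBase _⟩

end
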